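/- Conventions. Manifolds are smooth, finite-dimensional, Hausdorff, second countable, non-empty and without boundary. $\mathsf{Sec}(A)$ denotes the smooth sections of a vector bundle $A\to M$. A Lie algebroid over $M$ is a vector bundle $A\to M$ with a Lie bracket on the real vector space $\mathsf{Sec}(A)$ and a vector bundle map $\rho:A\to TM$ (the anchor) such that $[u,fv]=\rho_u(f)\,v+f\,[u,v]$ for $u,v\in\mathsf{Sec}(A)$, $f\in C^\infty(M)$. A metric $g$ on $A$ is a smooth symmetric bilinear form on the fibres; $\ker(g)=\{u\in\mathsf{Sec}(A): g(u,v)=0 \text{ for all } v\in\mathsf{Sec}(A)\}$, and $g$ is degenerate if $\ker(g)\neq\{0\}$. A Carrollian Lie algebroid $(A,[-,-],\rho,g,L)$ is a Lie algebroid with a degenerate metric $g$ and a trivial line subbundle $L\subset A$ such that $\ker(g)=\mathsf{Sec}(L)$; its Carroll distribution is $\mathcal C:=\rho(L)\subset TM$. A distribution (a choice of a subspace of each tangent space) is singular if its rank is not constant, and integrable (in the sense of Stefan and Sussmann) if it is spanned by a family of smooth vector fields and invariant under the local flows of the members of that family. A Carrollian structure $(\hat g,\kappa)$ on a manifold $P$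 consists of a metric $\hat g$ on $TP$ with pointwise diagonalisation $\mathrm{diag}(1,\dots,1,0)$ and a nowhere vanishing complete vector field $\kappa$ that spans the kernel of $\hat g$ at each point. Let $G$ be a Lie group and $\tau:P\to M$ a principal $G$-bundle with right action $\mathsf a_{\mathsf g}:P\to P$, $\mathsf g\in G$. Let $(\hat g,\kappa)$ be a Carrollian structure on $P$ that is $G$-invariant, i.e. $\hat g_{\mathsf a_{\mathsf g}(p)}(d\mathsf a_{\mathsf g}v,d\mathsf a_{\mathsf g}w)=\hat g_p(v,w)$ and $d\mathsf a_{\mathsf g}(\kappa_p)=\kappa_{\mathsf a_{\mathsf g}(p)}$ for all $\mathsf g\in G$, $p\in P$, $v,w\in T_pP$. 1. The orbit space $A:=TP/G$ is a smooth vector bundle over $M$ for which the quotient map $TP\to A$ is smooth and is a linear isomorphism $T_pP\cong A_{\tau(p)}$ for each $p\in P$. Assigning to $u\in\mathsf{Sec}(A)$ the vector field $\iota(u)$ on $P$ whose value at $p$ is the vector in $T_pP$ of class $u(\tau(p))$ is a bijection of $\mathsf{Sec}(A)$ onto the smooth $G$-invariant vector fields on $P$. There is a Carrollian Lie algebroid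 $(A,[-,-],\rho,g,L)$ such that - $\iota([u,v])=[\iota(u),\iota(v)]$ for all $u,v\in\mathsf{Sec}(A)$, and $\rho$ is induced by $d\tau:TP\to TM$ (so the underlying Lie algebroid is the Atiyah algebroid of $P$); - $g$ is the reduction of $\hat g$: $g_{\tau(p)}([v],[w])=\hat g_p(v,w)$ for $p\in P$, $v,w\in T_pP$; - $L$ is spanned by the section $\sigma:=\iota^{-1}(\kappa)$, and $L_m$ is the kernel of the bilinear form $g_m$ for every $m\in M$. Its Carroll distribution is given by $\mathcal C_{\tau(p)}=\mathrm{span}\{d\tau(\kappa_p)\}$ for $p\in P$, and is an integrable distribution. 2. The Carroll distribution is in general singular: already on a principal circle bundle $\mathbb R\times S^1\to\mathbb R$ there is an $S^1$-invariant Carrollian structure for which the Carroll distribution of the induced Carrollian Lie algebroid on $T(\mathbb R\times S^1)/S^1$ is singular. -/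

import Mathlib

open Set Bundle Topology
open scoped Manifold ContDiff

noncomputable section

/-! ## Lie algebroids, metrics on them, Carrollian Lie algebroids -/

section Algebroids

variable {E : Type*} [NormedAddCommGroup E] [NormedSpace ℝ E]
  {H : Type*} [TopologicalSpace H] (I : ModelWithCorners ℝ E H)
  {M : Type*} [TopologicalSpace M] [ChartedSpace H M]
  (F : Type*) [NormedAddCommGroup F] [NormedSpace ℝ F]
  (A : M → Type*) [∀ x, AddCommGroup (A x)] [∀ x, Module ℝ (A x)]
  [∀ x, TopologicalSpace (A x)] [TopologicalSpace (TotalSpace F A)]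
  [FiberBundle F A] [VectorBundle ℝ F A]

/-- The derivative `v(f)` of a real function in the direction of a tangent vector `v`. -/
def dirDeriv (f : M → ℝ) (x : M) (v : TangentSpace I x) : ℝ := mfderiv I 𝓘(ℝ, ℝ) f x v

variable {I F A} in
/-- The product of a smooth function and a smooth section. -/
def smulSection (f : C^∞⟮I, M; ℝ⟯) (u : Cₛ^∞⟮I; F, A⟯) : Cₛ^∞⟮I; F, A⟯ where
  toFun x := f x • u x
  contMDiff_toFun := f.contMDiff.smul_section u.contMDiff

/-- A Lie algebroid structure on the smooth vector bundle `A → M`: a Lie bracket on the real vector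
space of smooth sections of `A` and a smooth vector bundle map `A → TM`, related by the Leibniz
rule. -/
structure LieAlgebroid [IsManifold I ∞ M] where
  bracket : Cₛ^∞⟮I; F, A⟯ →ₗ[ℝ] Cₛ^∞⟮I; F, A⟯ →ₗ[ℝ] Cₛ^∞⟮I; F, A⟯
  bracket_self : ∀ u, bracket u u = 0
  jacobi : ∀ u v w, bracket u (bracket v w) + bracket v (bracket w u) + bracket w (bracket u v) = 0
  anchor : ∀ x, A x →ₗ[ℝ] TangentSpace I x
  smooth_anchor : ContMDiff (I.prod 𝓘(ℝ, F)) I.tangent ∞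
    (fun a : TotalSpace F A => (⟨a.proj, anchor a.proj a.snd⟩ : TangentBundle I M))
  leibniz : ∀ (u v : Cₛ^∞⟮I; F, A⟯) (f : C^∞⟮I, M; ℝ⟯) (x : M),
    bracket u (smulSection f v) x =
      dirDeriv I f x (anchor x (u x)) • v x + f x • bracket u v x

/-- A (possibly degenerate) metric on a vector bundle: a symmetric bilinear form on each fibre,
varying smoothly, i.e. pairing smooth sections to smooth functions. -/
structure BundleMetric where
  form : ∀ x, A x →ₗ[ℝ] A x →ₗ[ℝ] ℝ
  symm : ∀ x (v w : A x), form x v w = form x w v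
  smooth : ∀ u v : Cₛ^∞⟮I; F, A⟯, ContMDiff I 𝓘(ℝ, ℝ) ∞ (fun x => form x (u x) (v x))

variable {I F A} in
/-- The kernel of a metric, as a set of smooth sections. -/
def BundleMetric.ker (g : BundleMetric I F A) : Set Cₛ^∞⟮I; F, A⟯ :=
  {u | ∀ (v : Cₛ^∞⟮I; F, A⟯) (x : M), g.form x (u x) (v x) = 0}

variable {I F A} in
/-- A metric is degenerate if its kernel does not consist of the zero section only. -/
def BundleMetric.IsDegenerate (g : BundleMetric I F A) : Prop := g.ker ≠ {0}

/-- The smooth sections of `A` with values in a family `L` of subspaces of its fibres. -/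
def sectionsIn (L : ∀ x, Submodule ℝ (A x)) : Set Cₛ^∞⟮I; F, A⟯ := {u | ∀ x, u x ∈ L x}

/-- `L` is a trivial line subbundle of `A`: it has a global frame, that is, a nowhere vanishing
smooth section of `A` spanning it in each fibre. -/
def IsTrivialLineSubbundle (L : ∀ x, Submodule ℝ (A x)) : Prop :=
  ∃ σ : Cₛ^∞⟮I; F, A⟯, ∀ x, σ x ≠ 0 ∧ L x = Submodule.span ℝ {σ x}

/-- A Carrollian Lie algebroid structure on the vector bundle `A`: a Lie algebroid structure with a
degenerate metric and a trivial line subbundle whose sections are the kernel of the metric. -/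
structure CarrollianLieAlgebroid [IsManifold I ∞ M] extends LieAlgebroid I F A where
  metric : BundleMetric I F A
  degenerate : metric.IsDegenerate
  L : ∀ x, Submodule ℝ (A x)
  trivial_L : IsTrivialLineSubbundle I F A L
  ker_eq : metric.ker = sectionsIn I F A L

variable {I F A} in
/-- The Carroll distribution `ρ(L) ⊆ TM`. -/
def CarrollianLieAlgebroid.carrollDistribution [IsManifold I ∞ M] (C : CarrollianLieAlgebroid I F A) (x : M) :
    Submodule ℝ (TangentSpace I x) := (C.L x).map (C.anchor x)

variable {I} in
/-- A distribution (a choice of a subspace of each tangent space) is regular if the dimension of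
these subspaces is constant. -/
def IsRegularDistribution (D : ∀ x : M, Submodule ℝ (TangentSpace I x)) : Prop :=
  ∀ x y, Module.finrank ℝ (D x) = Module.finrank ℝ (D y)

variable {I} in
/-- A distribution is singular if it is not regular. -/
def IsSingularDistribution (D : ∀ x : M, Submodule ℝ (TangentSpace I x)) : Prop :=
  ¬ IsRegularDistribution D

/-- `Φ : ℝ × M → M` is, on `(-ε, ε) × U`, a smooth local flow of the vector field `X`. -/
structure IsLocalFlow (X : ∀ x : M, TangentSpace I x) (U : Set M) (ε : ℝ) (Φ : ℝ → M → M) :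
    Prop where
  isOpen : IsOpen U
  zero : ∀ y ∈ U, Φ 0 y = y
  integralCurve : ∀ y ∈ U, IsMIntegralCurveOn (I := I) (fun t => Φ t y) X (Ioo (-ε) ε)
  smooth : ContMDiffOn (𝓘(ℝ, ℝ).prod I) I ∞ (fun q : ℝ × M => Φ q.1 q.2) (Ioo (-ε) ε ×ˢ U)

variable {I} in
/-- A (not necessarily regular) distribution is integrable, in the sense of Stefan and Sussmann, if
it is spanned by a family of smooth vector fields and is invariant under the local flows of
these. -/
def IsIntegrableDistribution [IsManifold I ∞ M]
    (D : ∀ x : M, Submodule ℝ (TangentSpace I x)) : Prop :=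
  ∃ S : Set Cₛ^∞⟮I; E, (TangentSpace I : M → Type _)⟯,
    (∀ x, D x = Submodule.span ℝ {v | ∃ X ∈ S, v = X x}) ∧
    ∀ X ∈ S, ∀ (U : Set M) (ε : ℝ) (Φ : ℝ → M → M), IsLocalFlow I (fun x => X x) U ε Φ →
      ∀ t ∈ Ioo (-ε) ε, ∀ y ∈ U,
        (D y).map (mfderiv I I (Φ t) y).toLinearMap = D (Φ t y)

end Algebroids

/-! ## Carrollian structures on manifolds -/

section Carrollian

variable {E : Type*} [NormedAddCommGroup E] [NormedSpace ℝ E]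
  {H : Type*} [TopologicalSpace H] (I : ModelWithCorners ℝ E H)
  (P : Type*) [TopologicalSpace P] [ChartedSpace H P] [IsManifold I ∞ P]

/-- A (weak) Carrollian structure on a manifold `P`: a metric `g` whose pointwise diagonalisation is
`diag(1, …, 1, 0)` and a nowhere vanishing complete smooth vector field `κ`, the Carroll vector
field, which spans the kernel of `g`. -/
structure CarrollianStructure where
  g : BundleMetric I E (TangentSpace I : P → Type _)
  κ : Cₛ^∞⟮I; E, (TangentSpace I : P → Type _)⟯
  diagonal : ∀ p, ∃ (n : ℕ) (b : Module.Basis (Fin (n + 1)) ℝ (TangentSpace I p)),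
    ∀ i j, g.form p (b i) (b j) = if i = j ∧ i ≠ Fin.last n then 1 else 0
  κ_ne_zero : ∀ p, κ p ≠ 0
  complete : ∀ p, ∃ γ : ℝ → P, γ 0 = p ∧ IsMIntegralCurve (I := I) γ (fun x => κ x)
  ker_eq_span : ∀ p (v : TangentSpace I p),
    (∀ w, g.form p v w = 0) ↔ v ∈ Submodule.span ℝ {κ p}

end Carrollian

/-! ## Principal bundles and their Atiyah bundles -/

section Principal

variable {EP : Type*} [NormedAddCommGroup EP] [NormedSpace ℝ EP]
  {HP : Type*} [TopologicalSpace HP] (IP : ModelWithCorners ℝ EP HP)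
  {EM : Type*} [NormedAddCommGroup EM] [NormedSpace ℝ EM]
  {HM : Type*} [TopologicalSpace HM] (IM : ModelWithCorners ℝ EM HM)
  {EG : Type*} [NormedAddCommGroup EG] [NormedSpace ℝ EG]
  {HG : Type*} [TopologicalSpace HG] (IG : ModelWithCorners ℝ EG HG)
  (P : Type*) [TopologicalSpace P] [ChartedSpace HP P]
  (M : Type*) [TopologicalSpace M] [ChartedSpace HM M]
  (G : Type*) [TopologicalSpace G] [ChartedSpace HG G] [Group G]

/-- A smooth principal `G`-bundle `P → M`, with its right action `P × G → P`. It is locally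
isomorphic, as a smooth bundle with right `G`-action, to `U × G → U`. -/
structure PrincipalBundle where
  proj : P → M
  act : P → G → P
  smooth_proj : ContMDiff IP IM ∞ proj
  smooth_act : ContMDiff (IP.prod IG) IP ∞ (fun x : P × G => act x.1 x.2)
  act_one : ∀ p, act p 1 = p
  act_mul : ∀ p g h, act (act p g) h = act p (g * h)
  proj_act : ∀ p g, proj (act p g) = proj p
  locally_trivial : ∀ m : M, ∃ e : Trivialization G proj, m ∈ e.baseSet ∧
    ContMDiffOn IP (IM.prod IG) ∞ e.toOpenPartialHomeomorph e.source ∧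
    ContMDiffOn (IM.prod IG) IP ∞ e.toOpenPartialHomeomorph.symm e.target ∧
    ∀ p ∈ e.source, ∀ g : G, e (act p g) = ((e p).1, (e p).2 * g)

namespace PrincipalBundle

variable {IP IM IG P M G}
variable (B : PrincipalBundle IP IM IG P M G)

theorem exists_proj_eq (m : M) : ∃ p, B.proj p = m := by
  obtain ⟨e, hm, -⟩ := B.locally_trivial m
  exact ⟨e.toOpenPartialHomeomorph.symm (m, 1), e.proj_symm_apply' hm⟩

theorem eq_one_of_act_eq {p : P} {g : G} (h : B.act p g = p) : g = 1 := by
  obtain ⟨e, hm, -, -, he⟩ := B.locally_trivial (B.proj p)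
  have := he p (e.mem_source.2 hm) g
  rw [h] at this
  have h2 := congrArg Prod.snd this
  simpa using h2

theorem exists_act_eq {p q : P} (h : B.proj p = B.proj q) : ∃ g, B.act p g = q := by
  obtain ⟨e, hm, -, -, he⟩ := B.locally_trivial (B.proj p)
  have hp : p ∈ e.source := e.mem_source.2 hm
  have hq : q ∈ e.source := e.mem_source.2 (h ▸ hm)
  refine ⟨(e p).2⁻¹ * (e q).2, ?_⟩
  have hpg : B.act p ((e p).2⁻¹ * (e q).2) ∈ e.source :=
    e.mem_source.2 (by rw [B.proj_act]; exact hm)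
  apply e.injOn hpg hq
  change e _ = e q
  rw [he p hp, mul_inv_cancel_left]
  refine Prod.ext ?_ rfl
  rw [e.coe_fst hp, e.coe_fst hq, h]

/-- The diffeomorphism `a_g : P → P` given by the right action of `g`. -/
def actBy (g : G) : P → P := fun p => B.act p g

theorem contMDiff_actBy (g : G) : ContMDiff IP IP ∞ (B.actBy g) :=
  B.smooth_act.comp (contMDiff_id.prodMk contMDiff_const)

theorem mdifferentiable_actBy (g : G) : MDifferentiable IP IP (B.actBy g) :=
  (B.contMDiff_actBy g).mdifferentiable (by simp)

/-- The induced right action of `G` on `TP`. -/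
def tangentAct (g : G) : TangentBundle IP P → TangentBundle IP P := tangentMap IP IP (B.actBy g)

theorem tangentAct_one (X : TangentBundle IP P) : B.tangentAct 1 X = X := by
  have : B.actBy 1 = id := funext B.act_one
  rw [tangentAct, this, tangentMap_id]; rfl

theorem tangentAct_tangentAct (g h : G) (X : TangentBundle IP P) :
    B.tangentAct h (B.tangentAct g X) = B.tangentAct (g * h) X := by
  have : B.actBy (g * h) = B.actBy h ∘ B.actBy g := funext fun p => (B.act_mul p g h).symm
  rw [tangentAct, tangentAct, tangentAct, this,
    tangentMap_comp (B.mdifferentiable_actBy h) (B.mdifferentiable_actBy g)]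
  rfl

/-- Two tangent vectors of `P` are equivalent if they lie in the same `G`-orbit. -/
def tangentSetoid : Setoid (TangentBundle IP P) where
  r X Y := ∃ g, B.tangentAct g X = Y
  iseqv :=
    { refl := fun X => ⟨1, B.tangentAct_one X⟩
      symm := by
        rintro X Y ⟨g, rfl⟩
        exact ⟨g⁻¹, by rw [tangentAct_tangentAct, mul_inv_cancel, tangentAct_one]⟩
      trans := by
        rintro X Y Z ⟨g, rfl⟩ ⟨h, rfl⟩
        exact ⟨g * h, (B.tangentAct_tangentAct g h X).symm⟩ }

/-- The orbit space `TP/G`. -/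
def TangentQuotient : Type _ := Quotient B.tangentSetoid

/-- The projection `TP/G → M`. -/
def quotientProj : B.TangentQuotient → M :=
  Quotient.lift (fun X : TangentBundle IP P => B.proj X.proj) (by
    rintro X Y ⟨g, rfl⟩
    exact (B.proj_act X.proj g).symm)

/-- The fibre over `m` of the Atiyah bundle `TP/G → M`. -/
def AtiyahFibre (m : M) : Type _ := {q : B.TangentQuotient // B.quotientProj q = m}

variable {B} in
/-- The class in `(TP/G)_m` of a tangent vector at a point `p` over `m`. -/
def mkAt {m : M} {p : P} (h : B.proj p = m) (v : TangentSpace IP p) : B.AtiyahFibre m :=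
  ⟨Quotient.mk B.tangentSetoid ⟨p, v⟩, h⟩

theorem mkAt_bijective {m : M} {p : P} (h : B.proj p = m) :
    Function.Bijective (mkAt h : TangentSpace IP p → B.AtiyahFibre m) := by
  constructor
  · intro v w hvw
    obtain ⟨g, hg⟩ := Quotient.exact (congrArg Subtype.val hvw)
    have h1 : g = 1 := B.eq_one_of_act_eq (congrArg TotalSpace.proj hg)
    rw [h1, tangentAct_one] at hg
    exact TotalSpace.mk_injective p hg
  · rintro ⟨q, hq⟩
    induction q using Quotient.inductionOn with
    | h X =>
      obtain ⟨g, rfl⟩ := B.exists_act_eq (p := X.proj) (q := p) (hq.trans h.symm)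
      exact ⟨(B.tangentAct g X).snd,
        Subtype.ext (Quotient.sound (B.tangentSetoid.symm ⟨g, rfl⟩))⟩

/-- An auxiliary choice of a point over `m`, used to transport the vector space structure of a
tangent space to the fibre `(TP/G)_m`; by `mkAt_add` and `mkAt_smul` the result does not depend on
it. -/
def pointOver (m : M) : P := (B.exists_proj_eq m).choose

theorem proj_pointOver (m : M) : B.proj (B.pointOver m) = m := (B.exists_proj_eq m).choose_spec

/-- The bijection of `(TP/G)_m` with the tangent space at the chosen point. -/
def fibreEquivAux (m : M) : B.AtiyahFibre m ≃ TangentSpace IP (B.pointOver m) :=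
  (Equiv.ofBijective _ (B.mkAt_bijective (B.proj_pointOver m))).symm

instance (m : M) : AddCommGroup (B.AtiyahFibre m) := (B.fibreEquivAux m).addCommGroup

instance (m : M) : Module ℝ (B.AtiyahFibre m) := (B.fibreEquivAux m).module ℝ

/-- The identification of the tangent space at the chosen point over `m` with `(TP/G)_m`. -/
def pointEquiv (m : M) : TangentSpace IP (B.pointOver m) ≃ₗ[ℝ] B.AtiyahFibre m :=
  ((B.fibreEquivAux m).linearEquiv ℝ).symm

theorem mkAt_act {m : M} {p : P} (h : B.proj p = m) (g : G) (v : TangentSpace IP p) :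
    mkAt (B := B) (p := B.actBy g p) ((B.proj_act p g).trans h)
      (mfderiv IP IP (B.actBy g) p v) = mkAt h v :=
  Subtype.ext (Quotient.sound (B.tangentSetoid.symm ⟨g, rfl⟩))

theorem exists_mkAt_eq {m : M} {p : P} (h : B.proj p = m) :
    ∃ T : TangentSpace IP (B.pointOver m) →ₗ[ℝ] TangentSpace IP p,
      ∀ v, mkAt h (T v) = B.pointEquiv m v := by
  obtain ⟨g, rfl⟩ := B.exists_act_eq ((B.proj_pointOver m).trans h.symm)
  exact ⟨(mfderiv IP IP (B.actBy g) (B.pointOver m)).toLinearMap,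
    fun v => B.mkAt_act (B.proj_pointOver m) g v⟩

theorem exists_mkAt_linear {m : M} {p : P} (h : B.proj p = m) :
    ∃ T : TangentSpace IP p → TangentSpace IP (B.pointOver m),
      (∀ v w, T (v + w) = T v + T w) ∧ (∀ (c : ℝ) v, T (c • v) = c • T v) ∧
      ∀ v, mkAt h v = B.pointEquiv m (T v) := by
  obtain ⟨T, hT⟩ := B.exists_mkAt_eq h
  have hb : Function.Bijective T := by
    have : (mkAt h) ∘ T = B.pointEquiv m := funext hT
    exact ((B.mkAt_bijective h).of_comp_iff' T).1 (this ▸ (B.pointEquiv m).bijective)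
  refine ⟨(LinearEquiv.ofBijective T hb).symm, map_add _, map_smul _, fun v => ?_⟩
  rw [← hT]
  congr 1
  exact ((LinearEquiv.ofBijective T hb).apply_symm_apply v).symm

theorem mkAt_add {m : M} {p : P} (h : B.proj p = m) (v w : TangentSpace IP p) :
    mkAt h (v + w) = mkAt h v + mkAt h w := by
  obtain ⟨T, h1, -, h3⟩ := B.exists_mkAt_linear h
  rw [h3, h3, h3, h1, map_add]

theorem mkAt_smul {m : M} {p : P} (h : B.proj p = m) (c : ℝ) (v : TangentSpace IP p) :
    mkAt h (c • v) = c • mkAt h v := by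
  obtain ⟨T, -, h2, h3⟩ := B.exists_mkAt_linear h
  rw [h3, h3, h2, map_smul]

/-- The linear isomorphism `T_pP → (TP/G)_{τ(p)}` sending a tangent vector to its class. -/
def fibreEquiv (p : P) : TangentSpace IP p ≃ₗ[ℝ] B.AtiyahFibre (B.proj p) :=
  LinearEquiv.ofBijective
    { toFun := mkAt rfl, map_add' := B.mkAt_add rfl, map_smul' := B.mkAt_smul rfl }
    (B.mkAt_bijective rfl)

/-- The quotient map `TP → TP/G`, onto the total space of the Atiyah bundle. -/
def quotientMap (X : TangentBundle IP P) : TotalSpace EP B.AtiyahFibre :=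
  ⟨B.proj X.proj, B.fibreEquiv X.proj X.snd⟩

variable [IsManifold IP ∞ P]

/-- `TP/G` carries the quotient topology. -/
instance : TopologicalSpace (TotalSpace EP B.AtiyahFibre) :=
  TopologicalSpace.coinduced B.quotientMap inferInstance

instance (m : M) : TopologicalSpace (B.AtiyahFibre m) :=
  TopologicalSpace.induced (TotalSpace.mk' EP m) inferInstance

/-- A vector field on `P` is `G`-invariant. -/
def IsInvariantField (X : ∀ p : P, TangentSpace IP p) : Prop :=
  ∀ (g : G) (p : P), mfderiv IP IP (B.actBy g) p (X p) = X (B.actBy g p)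

/-- A Carrollian structure on `P` is `G`-invariant. -/
structure IsInvariant (S : CarrollianStructure IP P) : Prop where
  metric : ∀ (g : G) (p : P) (v w : TangentSpace IP p),
    S.g.form (B.actBy g p) (mfderiv IP IP (B.actBy g) p v) (mfderiv IP IP (B.actBy g) p w)
      = S.g.form p v w
  field : B.IsInvariantField fun p => S.κ p

/-- The vector field `ι(u)` on `P` determined by a section `u` of `TP/G`: its value at `p` is the
unique tangent vector at `p` with class `u(τ(p))`. -/
def inclusion (u : ∀ m, B.AtiyahFibre m) (p : P) : TangentSpace IP p :=
  (B.fibreEquiv p).symm (u (B.proj p))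

section Structure

variable [IsManifold IM ∞ M] [FiberBundle EP B.AtiyahFibre] [VectorBundle ℝ EP B.AtiyahFibre]

/-- The vector bundle structure on `TP/G` is the quotient one: the quotient map is smooth, and the
inclusion `ι` is a bijection of the smooth sections of `TP/G` onto the smooth `G`-invariant vector
fields on `P`. -/
structure IsAtiyahBundle : Prop where
  smooth_quotientMap : ContMDiff IP.tangent (IM.prod 𝓘(ℝ, EP)) ∞ B.quotientMap
  smooth_inclusion : ∀ u : Cₛ^∞⟮IM; EP, B.AtiyahFibre⟯,
    ContMDiff IP IP.tangent ∞
      (fun p => (⟨p, B.inclusion (fun m => u m) p⟩ : TangentBundle IP P))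
  invariant_inclusion : ∀ u : Cₛ^∞⟮IM; EP, B.AtiyahFibre⟯,
    B.IsInvariantField (B.inclusion fun m => u m)
  exists_section : ∀ X : Cₛ^∞⟮IP; EP, (TangentSpace IP : P → Type _)⟯,
    B.IsInvariantField (fun p => X p) →
      ∃! u : Cₛ^∞⟮IM; EP, B.AtiyahFibre⟯, ∀ p, B.inclusion (fun m => u m) p = X p

variable {B} in
/-- The Lie algebroid structure on `TP/G` is that of the Atiyah algebroid: the bracket is that of
`G`-invariant vector fields, and the anchor is induced by the differential of `τ : P → M`. -/
structure IsAtiyahAlgebroid (𝒜 : LieAlgebroid IM EP B.AtiyahFibre) : Prop where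
  bracket : ∀ (u v : Cₛ^∞⟮IM; EP, B.AtiyahFibre⟯) (p : P),
    B.inclusion (fun m => 𝒜.bracket u v m) p =
      VectorField.mlieBracket IP (B.inclusion fun m => u m) (B.inclusion fun m => v m) p
  anchor : ∀ (p : P) (v : TangentSpace IP p),
    𝒜.anchor (B.proj p) (B.fibreEquiv p v) = mfderiv IP IM B.proj p v

variable {B} in
/-- The Carrollian Lie algebroid `𝒜` on `TP/G` is induced by the Carrollian structure `S` on `P`: its
Lie algebroid is the Atiyah algebroid, its metric is the reduction of that of `S`, and its line
bundle is spanned by the section of `TP/G` that corresponds to the Carroll vector field. -/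
structure IsInducedBy (𝒜 : CarrollianLieAlgebroid IM EP B.AtiyahFibre)
    (S : CarrollianStructure IP P) : Prop where
  atiyah : IsAtiyahAlgebroid 𝒜.toLieAlgebroid
  metric : ∀ (p : P) (v w : TangentSpace IP p),
    𝒜.metric.form (B.proj p) (B.fibreEquiv p v) (B.fibreEquiv p w) = S.g.form p v w
  line : ∃ σ : Cₛ^∞⟮IM; EP, B.AtiyahFibre⟯,
    (∀ p, B.inclusion (fun m => σ m) p = S.κ p) ∧ ∀ m, 𝒜.L m = Submodule.span ℝ {σ m}

end Structure

end PrincipalBundle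

end Principal

end

noncomputable section

/-! The bundle `TP/G` is trivialized by local sections. Over an open set `U` with a smooth section
`s` of `P → M`, the action is free and transitive on fibres, so every class in `(TP/G)_m` has
exactly one representative at `s m`; thus `TP/G` over `U` is the pullback of `TP` along `s`. If `s`
takes values in a single chart domain of `P`, the trivialization of `TP` there gives coordinates on
`TP/G`. Writing `p = s(τ p) · γ(p)` with `γ` smooth, the representative at `s(τ p)` of the class of
`X ∈ T_pP` is `X · γ(p)⁻¹`, which is smooth in `X`. From this follow the smoothness of the quotient
map, of the coordinate changes and of `ι(u)`. Conversely, an invariant field restricted to `s` and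
projected gives a smooth local section of `TP/G`.

The bracket of invariant fields is invariant because Lie brackets are natural under the
diffeomorphisms `a_g`. As `ι` is injective, the bracket axioms on sections of `TP/G` reduce to those
on `P`. The anchor is well defined since `τ ∘ a_g = τ`, and the Leibniz rule holds because `ι(fv) =
(f ∘ τ) ι(v)`.

Invariance lets the metric and `κ` descend. Each `T_pP → (TP/G)_{τ(p)}` is a linear isometry
carrying `κ_p` to `σ`, so `σ` spans the kernel of the reduced form in every fibre. Since every
vector of a fibre is the value of a global section, the kernel defined by sections is the pointwise
one. The Carroll distribution is spanned by the single global field `ρ(σ)`, zeros allowed, and a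
field is preserved by its own local flows: hence integrability.

For the singular example, on `ℝ × S¹` take `κ = x∂_x + ∂_θ` and the metric `(dx - x dθ)²`. Then
`dτ(κ) = x∂_x`, so the rank is 0 over `x = 0` and 1 elsewhere. -/

/-- A family of continuous linear maps on a finite-dimensional space is smooth as soon as it is
pointwise smooth. -/
theorem contMDiffOn_clm_of_apply {E : Type*} [NormedAddCommGroup E] [NormedSpace ℝ E]
    {H : Type*} [TopologicalSpace H] {I : ModelWithCorners ℝ E H}
    {M : Type*} [TopologicalSpace M] [ChartedSpace H M]
    {F : Type*} [NormedAddCommGroup F] [NormedSpace ℝ F] [FiniteDimensional ℝ F]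
    {F' : Type*} [NormedAddCommGroup F'] [NormedSpace ℝ F']
    {f : M → F →L[ℝ] F'} {s : Set M} {n : ℕ∞ω}
    (h : ∀ w, ContMDiffOn I 𝓘(ℝ, F') n (fun m => f m w) s) :
    ContMDiffOn I 𝓘(ℝ, F →L[ℝ] F') n f s := by
  let b := Module.finBasis ℝ F
  have key : ∀ m, f m = ∑ i, ContinuousLinearMap.smulRightL ℝ F F'
      (LinearMap.toContinuousLinearMap (b.coord i)) (f m (b i)) := by
    intro m
    ext w
    conv_lhs => rw [← b.sum_repr w]
    rw [map_sum]
    simp [Module.Basis.coord_apply]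
  have : f = fun m => ∑ i, ContinuousLinearMap.smulRightL ℝ F F'
      (LinearMap.toContinuousLinearMap (b.coord i)) (f m (b i)) := funext key
  rw [this]
  exact contMDiffOn_finsetSum fun i _ =>
    (ContinuousLinearMap.contMDiff _).comp_contMDiffOn (h (b i))

/-! ### Local sections of a principal bundle and representatives of classes in `TP/G` -/

namespace PrincipalBundle

variable {EP : Type*} [NormedAddCommGroup EP] [NormedSpace ℝ EP]
  {HP : Type*} [TopologicalSpace HP] {IP : ModelWithCorners ℝ EP HP}
  {EM : Type*} [NormedAddCommGroup EM] [NormedSpace ℝ EM]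
  {HM : Type*} [TopologicalSpace HM] {IM : ModelWithCorners ℝ EM HM}
  {EG : Type*} [NormedAddCommGroup EG] [NormedSpace ℝ EG]
  {HG : Type*} [TopologicalSpace HG] {IG : ModelWithCorners ℝ EG HG}
  {P : Type*} [TopologicalSpace P] [ChartedSpace HP P]
  {M : Type*} [TopologicalSpace M] [ChartedSpace HM M]
  {G : Type*} [TopologicalSpace G] [ChartedSpace HG G] [Group G]
  (B : PrincipalBundle IP IM IG P M G)

/-- The class of a tangent vector, as a linear isomorphism onto the fibre of the Atiyah bundle. -/
def mkEquiv {m : M} {p : P} (h : B.proj p = m) : TangentSpace IP p ≃ₗ[ℝ] B.AtiyahFibre m :=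
  LinearEquiv.ofBijective
    { toFun := mkAt h, map_add' := B.mkAt_add h, map_smul' := B.mkAt_smul h }
    (B.mkAt_bijective h)

/-- Classes are compared in the total space, where replacing `m` by `B.proj p` needs no transport
between fibres. -/
theorem mk_mkEquiv {m : M} {p : P} (h : B.proj p = m) (v : TangentSpace IP p) :
    (⟨m, B.mkEquiv h v⟩ : TotalSpace EP B.AtiyahFibre) = B.quotientMap ⟨p, v⟩ := by
  subst h; rfl

theorem quotientMap_tangentAct (g : G) (X : TangentBundle IP P) :
    B.quotientMap (B.tangentAct g X) = B.quotientMap X := by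
  obtain ⟨p, v⟩ := X
  exact (B.mk_mkEquiv (p := B.actBy g p) (B.proj_act p g) _).symm.trans
    (congrArg (TotalSpace.mk (B.proj p)) (B.mkAt_act rfl g v))

/-- The action on `P` is free, so an orbit in `TP` meets each tangent space at most once. This is
the basic tool for identifying tangent vectors below: compare classes, then base points. -/
theorem eq_of_quotientMap_eq {X Y : TangentBundle IP P} (h : B.quotientMap X = B.quotientMap Y)
    (hp : X.proj = Y.proj) : X = Y := by
  obtain ⟨p, v⟩ := X
  obtain ⟨q, w⟩ := Y
  obtain rfl : p = q := hp
  have := TotalSpace.mk_injective (F := EP) (E := B.AtiyahFibre) (B.proj p) h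
  exact congrArg (TotalSpace.mk p) ((B.fibreEquiv p).injective this)

theorem quotientMap_surjective : Function.Surjective B.quotientMap := by
  rintro ⟨m, a⟩
  obtain ⟨p, rfl⟩ := B.exists_proj_eq m
  exact ⟨⟨p, (B.fibreEquiv p).symm a⟩, by simp [quotientMap]⟩

@[simp] theorem proj_quotientMap (X : TangentBundle IP P) :
    (B.quotientMap X).proj = B.proj X.proj := rfl

@[simp] theorem proj_tangentAct (g : G) (X : TangentBundle IP P) :
    (B.tangentAct g X).proj = B.act X.proj g := rfl

/-- A smooth local section of a principal bundle, with values in the domain of a chart of `P`, and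
the group component of the local trivialization that it determines. -/
structure LocalSection where
  base : Set M
  isOpen_base : IsOpen base
  toFun : M → P
  group : P → G
  centre : P
  smooth_toFun : ContMDiffOn IM IP ∞ toFun base
  smooth_group : ContMDiffOn IP IG ∞ group (B.proj ⁻¹' base)
  proj_toFun : ∀ m ∈ base, B.proj (toFun m) = m
  act_group : ∀ p, B.proj p ∈ base → B.act (toFun (B.proj p)) (group p) = p
  mem_chart : ∀ m ∈ base, toFun m ∈ (chartAt HP centre).source

theorem exists_localSection (m : M) : ∃ S : B.LocalSection, m ∈ S.base := by
  obtain ⟨e, hm, h1, h2, h3⟩ := B.locally_trivial m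
  let s : M → P := fun x => e.toOpenPartialHomeomorph.symm (x, 1)
  have hs : ContMDiffOn IM IP ∞ s e.baseSet :=
    h2.comp (contMDiff_id.prodMk contMDiff_const).contMDiffOn
      (fun x hx => e.mem_target.2 hx)
  -- The section of unit elements is restricted to where it stays in one chart domain of `P`, so
  -- that a single chart later trivializes `TP` along it.
  let U := e.baseSet ∩ s ⁻¹' (chartAt HP (s m)).source
  have hU : IsOpen U :=
    hs.continuousOn.isOpen_inter_preimage e.open_baseSet (chartAt HP (s m)).open_source
  have hsub : B.proj ⁻¹' U ⊆ e.source := fun p hp => e.mem_source.2 hp.1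
  refine ⟨⟨U, hU, s, fun p => (e p).2, s m, hs.mono inter_subset_left,
    contMDiff_snd.comp_contMDiffOn (h1.mono hsub),
    fun x hx => e.proj_symm_apply' hx.1, fun p hp => ?_, fun x hx => hx.2⟩,
    hm, mem_chart_source _ _⟩
  have hps : p ∈ e.source := hsub hp
  have hsp : s (B.proj p) ∈ e.source :=
    e.toOpenPartialHomeomorph.map_target (e.mem_target.2 hp.1)
  apply e.injOn (e.mem_source.2 ?_) hps
  · change e _ = e p
    rw [h3 _ hsp]
    have : e (s (B.proj p)) = (B.proj p, 1) := e.apply_symm_apply (e.mem_target.2 hp.1)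
    rw [this, one_mul]
    exact e.mk_proj_snd hps
  · rw [B.proj_act]
    exact e.mem_source.1 hsp

section TangentAct

variable [IsManifold IP ∞ P] [IsManifold IG ∞ G]

/-- The action on `TP` is the differential of `P × G → P` evaluated on the vectors `(v, 0)`; this
gives smoothness jointly in the vector and the group element. -/
theorem contMDiff_tangentAct :
    ContMDiff (IP.tangent.prod IG) IP.tangent ∞
      (fun x : TangentBundle IP P × G => B.tangentAct x.2 x.1) := by
  have h1 : ContMDiff (IP.tangent.prod IG) (IP.prod IG).tangent ∞
      (fun x : TangentBundle IP P × G =>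
        (equivTangentBundleProd IP P IG G).symm
          (x.1, (zeroSection EG (TangentSpace IG : G → Type _)) x.2)) :=
    contMDiff_equivTangentBundleProd_symm.comp
      (contMDiff_fst.prodMk ((contMDiff_zeroSection ℝ _).comp contMDiff_snd))
  have h2 := (B.smooth_act.contMDiff_tangentMap (m := ∞) (by simp)).comp h1
  convert h2 using 1
  funext x
  obtain ⟨⟨p, v⟩, g⟩ := x
  have hact := B.smooth_act.mdifferentiable (by simp) (p, g)
  have hpair : MDifferentiableAt IP (IP.prod IG) (fun q : P => (q, g)) p :=
    (contMDiff_id.prodMk contMDiff_const : ContMDiff IP (IP.prod IG) ∞ _).mdifferentiable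
      (by simp) p
  change (⟨B.actBy g p, mfderiv IP IP (B.actBy g) p v⟩ : TangentBundle IP P) =
    ⟨B.act p g, mfderiv (IP.prod IG) IP (fun x : P × G => B.act x.1 x.2) (p, g) (v, 0)⟩
  have : B.actBy g = (fun x : P × G => B.act x.1 x.2) ∘ (fun q : P => (q, g)) := rfl
  congr 1
  rw [this, mfderiv_comp p hact hpair, mfderiv_prod_left]
  rfl

end TangentAct

section Lift

variable (a : TotalSpace EP B.AtiyahFibre)

variable {B} in
/-- The representative, along a local section, of an element of the Atiyah bundle. -/
def LocalSection.lift (S : B.LocalSection) (a : TotalSpace EP B.AtiyahFibre) :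
    TangentBundle IP P :=
  B.tangentAct (S.group (B.quotientMap_surjective a).choose.proj)⁻¹
    (B.quotientMap_surjective a).choose

variable {B} (S : B.LocalSection)

@[simp] theorem LocalSection.quotientMap_lift : B.quotientMap (S.lift a) = a := by
  rw [lift, quotientMap_tangentAct]
  exact (B.quotientMap_surjective a).choose_spec

theorem LocalSection.act_group_inv {p : P} (hp : B.proj p ∈ S.base) :
    B.act p (S.group p)⁻¹ = S.toFun (B.proj p) := by
  have h := congrArg (fun q => B.act q (S.group p)⁻¹) (S.act_group p hp)
  simpa [B.act_mul, B.act_one] using h.symm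

theorem LocalSection.proj_lift (ha : a.proj ∈ S.base) : (S.lift a).proj = S.toFun a.proj := by
  have h := congrArg TotalSpace.proj (B.quotientMap_surjective a).choose_spec
  rw [proj_quotientMap] at h
  rw [lift, proj_tangentAct, S.act_group_inv (h ▸ ha), h]

/-- Replaces the arbitrary representative in `lift` by the given `X`, so that the choice disappears
and a formula smooth in `X` remains. -/
theorem LocalSection.lift_quotientMap {X : TangentBundle IP P} (hX : B.proj X.proj ∈ S.base) :
    S.lift (B.quotientMap X) = B.tangentAct (S.group X.proj)⁻¹ X := by
  refine B.eq_of_quotientMap_eq ?_ ?_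
  · rw [S.quotientMap_lift, quotientMap_tangentAct]
  · rw [S.proj_lift _ hX, proj_tangentAct, S.act_group_inv hX, proj_quotientMap]

theorem LocalSection.lift_eq {X : TangentBundle IP P} {m : M} (hm : m ∈ S.base)
    (hX : X.proj = S.toFun m) : S.lift (B.quotientMap X) = X := by
  have h : B.proj X.proj = m := by rw [hX, S.proj_toFun m hm]
  refine B.eq_of_quotientMap_eq (S.quotientMap_lift _) ?_
  rw [S.proj_lift _ (show B.proj X.proj ∈ S.base from h ▸ hm), proj_quotientMap, h, hX]

theorem LocalSection.lift_mkEquiv {m : M} (hm : m ∈ S.base)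
    (v : TangentSpace IP (S.toFun m)) :
    S.lift ⟨m, B.mkEquiv (S.proj_toFun m hm) v⟩ = ⟨S.toFun m, v⟩ := by
  rw [mk_mkEquiv, S.lift_eq hm rfl]

end Lift

/-- A chosen local section around a point. -/
def localSectionAt (m : M) : B.LocalSection := (B.exists_localSection m).choose

theorem mem_localSectionAt (m : M) : m ∈ (B.localSectionAt m).base :=
  (B.exists_localSection m).choose_spec

/-! ### The smooth vector bundle structure on `TP/G` -/

section Trivialization

variable [IsManifold IP ∞ P]

theorem isQuotientMap_quotientMap : IsQuotientMap B.quotientMap :=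
  ⟨⟨rfl⟩, B.quotientMap_surjective⟩

theorem continuous_quotientMap : Continuous B.quotientMap := B.isQuotientMap_quotientMap.continuous

theorem continuous_proj :
    Continuous (TotalSpace.proj : TotalSpace EP B.AtiyahFibre → M) := by
  rw [B.isQuotientMap_quotientMap.continuous_iff]
  exact B.smooth_proj.continuous.comp (FiberBundle.continuous_proj EP _)

variable {B} (S : B.LocalSection)

/-- The trivialization of `TP` near a local section. -/
abbrev LocalSection.tangentTriv :
    Trivialization EP (TotalSpace.proj : TangentBundle IP P → P) :=
  trivializationAt EP (TangentSpace IP) S.centre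

theorem LocalSection.mem_tangentTriv_source {X : TangentBundle IP P} {m : M} (hm : m ∈ S.base)
    (hX : X.proj = S.toFun m) : X ∈ S.tangentTriv.source := by
  rw [Trivialization.mem_source, hX]
  exact S.mem_chart m hm

theorem LocalSection.mem_tangentTriv_target {m : M} (hm : m ∈ S.base) (w : EP) :
    (S.toFun m, w) ∈ S.tangentTriv.target := by
  rw [Trivialization.mem_target]
  exact S.mem_chart m hm

/-- The vector of `TP` at a point of a local section with given coordinates. -/
def LocalSection.vector (x : M × EP) : TangentBundle IP P :=
  S.tangentTriv.toOpenPartialHomeomorph.symm (S.toFun x.1, x.2)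

theorem LocalSection.proj_vector {m : M} (hm : m ∈ S.base) (w : EP) :
    (S.vector (m, w)).proj = S.toFun m :=
  S.tangentTriv.proj_symm_apply (S.mem_tangentTriv_target hm w)

theorem LocalSection.contMDiffOn_vector :
    ContMDiffOn (IM.prod 𝓘(ℝ, EP)) IP.tangent ∞ S.vector (S.base ×ˢ univ) :=
  S.tangentTriv.contMDiffOn_symm.comp
    ((S.smooth_toFun.comp contMDiffOn_fst fun _ hx => hx.1).prodMk contMDiffOn_snd)
    fun x hx => S.mem_tangentTriv_target hx.1 x.2

/-- The coordinates of an element of the Atiyah bundle, with respect to a local section. -/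
def LocalSection.coord (a : TotalSpace EP B.AtiyahFibre) : EP := (S.tangentTriv (S.lift a)).2

theorem LocalSection.vector_coord {a : TotalSpace EP B.AtiyahFibre} (ha : a.proj ∈ S.base) :
    S.vector (a.proj, S.coord a) = S.lift a := by
  have h := S.mem_tangentTriv_source ha (S.proj_lift a ha)
  rw [vector, coord, ← S.proj_lift a ha, S.tangentTriv.mk_proj_snd h]
  exact S.tangentTriv.left_inv h

theorem LocalSection.coord_vector {m : M} (hm : m ∈ S.base) (w : EP) :
    S.coord (B.quotientMap (S.vector (m, w))) = w := by
  rw [coord, S.lift_eq hm (S.proj_vector hm w), vector,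
    S.tangentTriv.apply_symm_apply (S.mem_tangentTriv_target hm w)]

variable [LieGroup IG ∞ G]

theorem LocalSection.contMDiffOn_lift_quotientMap :
    ContMDiffOn IP.tangent IP.tangent ∞ (fun X => S.lift (B.quotientMap X))
      {X | B.proj X.proj ∈ S.base} := by
  have : IsManifold IG ∞ G := inferInstance
  have h : ContMDiffOn IP.tangent IG ∞ (fun X : TangentBundle IP P => (S.group X.proj)⁻¹)
      {X | B.proj X.proj ∈ S.base} :=
    (S.smooth_group.comp (contMDiff_proj _).contMDiffOn fun X hX => hX).inv
  exact (B.contMDiff_tangentAct.comp_contMDiffOn (contMDiffOn_id.prodMk h)).congr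
    fun X hX => S.lift_quotientMap hX

theorem LocalSection.contMDiffOn_coord_quotientMap :
    ContMDiffOn IP.tangent 𝓘(ℝ, EP) ∞ (fun X => S.coord (B.quotientMap X))
      {X | B.proj X.proj ∈ S.base} :=
  contMDiff_snd.comp_contMDiffOn
    (S.tangentTriv.contMDiffOn.comp S.contMDiffOn_lift_quotientMap
      fun _ hX => S.mem_tangentTriv_source hX (S.proj_lift _ hX))

/-- The trivialization of the Atiyah bundle determined by a local section of the principal
bundle. -/
def LocalSection.triv :
    Trivialization EP (TotalSpace.proj : TotalSpace EP B.AtiyahFibre → M) where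
  toFun a := (a.proj, S.coord a)
  invFun x := B.quotientMap (S.vector x)
  source := TotalSpace.proj ⁻¹' S.base
  target := S.base ×ˢ univ
  map_source' a ha := ⟨ha, mem_univ _⟩
  map_target' x hx := by
    change B.proj (S.vector (x.1, x.2)).proj ∈ S.base
    rw [S.proj_vector hx.1, S.proj_toFun _ hx.1]
    exact hx.1
  left_inv' a ha := by rw [S.vector_coord ha, S.quotientMap_lift]
  right_inv' x hx := by
    refine Prod.ext ?_ (S.coord_vector hx.1 x.2)
    change B.proj (S.vector (x.1, x.2)).proj = x.1
    rw [S.proj_vector hx.1, S.proj_toFun _ hx.1]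
  open_source := S.isOpen_base.preimage B.continuous_proj
  open_target := S.isOpen_base.prod isOpen_univ
  continuousOn_toFun := by
    refine B.continuous_proj.continuousOn.prodMk ?_
    -- Since `TP/G` has the quotient topology, continuity of the coordinates is checked on `TP`.
    rw [B.isQuotientMap_quotientMap.continuousOn_isOpen_iff
      (S.isOpen_base.preimage B.continuous_proj)]
    exact S.contMDiffOn_coord_quotientMap.continuousOn
  continuousOn_invFun :=
    B.continuous_quotientMap.comp_continuousOn S.contMDiffOn_vector.continuousOn
  baseSet := S.base
  open_baseSet := S.isOpen_base
  source_eq := rfl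
  target_eq := rfl
  proj_toFun _ _ := rfl

/-- Composed with the linear isomorphism from the tangent space at `S.toFun m`, the coordinates
become those of the chart of `TP`, which are linear. -/
instance LocalSection.isLinear_triv : S.triv.IsLinear ℝ where
  linear m hm := by
    have key : ∀ v : TangentSpace IP (S.toFun m),
        (S.triv ⟨m, B.mkEquiv (S.proj_toFun m hm) v⟩).2 = (S.tangentTriv ⟨S.toFun m, v⟩).2 :=
      fun v => congrArg (fun X => (S.tangentTriv X).2) (S.lift_mkEquiv hm v)
    have hlin := S.tangentTriv.linear ℝ (S.mem_chart m hm)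
    constructor
    · intro a a'
      obtain ⟨v, rfl⟩ := (B.mkEquiv (S.proj_toFun m hm)).surjective a
      obtain ⟨v', rfl⟩ := (B.mkEquiv (S.proj_toFun m hm)).surjective a'
      rw [← map_add, key, key, key]
      exact hlin.map_add v v'
    · intro c a
      obtain ⟨v, rfl⟩ := (B.mkEquiv (S.proj_toFun m hm)).surjective a
      rw [← map_smul, key, key]
      exact hlin.map_smul c v

/-- By finite dimension it suffices to fix a vector `w`: realize it along the first section, pass to
its class, and read the coordinates along the second. -/
theorem LocalSection.contMDiffOn_coordChangeL [FiniteDimensional ℝ EP] (S S' : B.LocalSection) :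
    ContMDiffOn IM 𝓘(ℝ, EP →L[ℝ] EP) ∞
      (fun m => (S.triv.coordChangeL ℝ S'.triv m : EP →L[ℝ] EP)) (S.base ∩ S'.base) := by
  refine contMDiffOn_clm_of_apply fun w => ?_
  have h : ContMDiffOn IM 𝓘(ℝ, EP) ∞
      (fun m => S'.coord (B.quotientMap (S.vector (m, w)))) (S.base ∩ S'.base) := by
    refine S'.contMDiffOn_coord_quotientMap.comp
      (S.contMDiffOn_vector.comp (contMDiff_id.prodMk contMDiff_const).contMDiffOn
        fun m hm => ⟨hm.1, mem_univ _⟩) fun m hm => ?_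
    change B.proj (S.vector (m, w)).proj ∈ S'.base
    rw [S.proj_vector hm.1, S.proj_toFun _ hm.1]
    exact hm.2
  exact h.congr fun m hm => S.triv.coordChangeL_apply' S'.triv hm w

variable (B)

instance fiberBundle : FiberBundle EP B.AtiyahFibre where
  totalSpaceMk_isInducing' _ := ⟨rfl⟩
  trivializationAtlas' := {e | ∃ S : B.LocalSection, S.triv = e}
  trivializationAt' m := (B.localSectionAt m).triv
  mem_baseSet_trivializationAt' := B.mem_localSectionAt
  trivialization_mem_atlas' _ := ⟨_, rfl⟩

theorem exists_eq_triv (e : Trivialization EP (TotalSpace.proj : TotalSpace EP B.AtiyahFibre → M))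
    [he : MemTrivializationAtlas e] : ∃ S : B.LocalSection, S.triv = e := he.out

instance (S : B.LocalSection) : MemTrivializationAtlas S.triv := ⟨⟨S, rfl⟩⟩

instance vectorBundle [FiniteDimensional ℝ EP] : VectorBundle ℝ EP B.AtiyahFibre where
  trivialization_linear' e he := by
    obtain ⟨S, rfl⟩ := B.exists_eq_triv e
    infer_instance
  continuousOn_coordChange' e e' he he' := by
    obtain ⟨S, rfl⟩ := B.exists_eq_triv e
    obtain ⟨S', rfl⟩ := B.exists_eq_triv e'
    exact (S.contMDiffOn_coordChangeL S').continuousOn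

instance contMDiffVectorBundle [FiniteDimensional ℝ EP] :
    ContMDiffVectorBundle ∞ EP B.AtiyahFibre IM where
  contMDiffOn_coordChangeL e e' he he' := by
    obtain ⟨S, rfl⟩ := B.exists_eq_triv e
    obtain ⟨S', rfl⟩ := B.exists_eq_triv e'
    exact S.contMDiffOn_coordChangeL S'

end Trivialization

end PrincipalBundle

/-! ### Sections of `TP/G` as invariant vector fields -/

namespace PrincipalBundle

variable {EP : Type*} [NormedAddCommGroup EP] [NormedSpace ℝ EP]
  {HP : Type*} [TopologicalSpace HP] {IP : ModelWithCorners ℝ EP HP}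
  {EM : Type*} [NormedAddCommGroup EM] [NormedSpace ℝ EM]
  {HM : Type*} [TopologicalSpace HM] {IM : ModelWithCorners ℝ EM HM}
  {EG : Type*} [NormedAddCommGroup EG] [NormedSpace ℝ EG]
  {HG : Type*} [TopologicalSpace HG] {IG : ModelWithCorners ℝ EG HG}
  {P : Type*} [TopologicalSpace P] [ChartedSpace HP P]
  {M : Type*} [TopologicalSpace M] [ChartedSpace HM M]
  {G : Type*} [TopologicalSpace G] [ChartedSpace HG G] [Group G]
  (B : PrincipalBundle IP IM IG P M G)

section Pointwise

theorem quotientMap_inclusion (u : ∀ m, B.AtiyahFibre m) (p : P) :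
    B.quotientMap ⟨p, B.inclusion u p⟩ = ⟨B.proj p, u (B.proj p)⟩ := by
  simp [quotientMap, inclusion]

theorem isInvariantField_inclusion (u : ∀ m, B.AtiyahFibre m) :
    B.IsInvariantField (B.inclusion u) := by
  intro g p
  refine TotalSpace.mk_injective (F := EP) (E := (TangentSpace IP : P → Type _)) _
    (B.eq_of_quotientMap_eq ?_ rfl)
  rw [quotientMap_inclusion]
  refine (B.quotientMap_tangentAct g ⟨p, B.inclusion u p⟩).trans ?_
  rw [quotientMap_inclusion]
  change _ = (⟨B.proj (B.act p g), u (B.proj (B.act p g))⟩ : TotalSpace EP B.AtiyahFibre)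
  rw [B.proj_act]

variable {B} in
theorem IsInvariantField.quotientMap_eq {X : ∀ p : P, TangentSpace IP p}
    (hX : B.IsInvariantField X) {p q : P} (h : B.proj p = B.proj q) :
    B.quotientMap ⟨p, X p⟩ = B.quotientMap ⟨q, X q⟩ := by
  obtain ⟨g, rfl⟩ := B.exists_act_eq h
  rw [← B.quotientMap_tangentAct g ⟨p, X p⟩]
  exact congrArg (fun v => B.quotientMap ⟨B.actBy g p, v⟩) (hX g p)

theorem isInvertible_mfderiv_actBy (g : G) (p : P) :
    (mfderiv IP IP (B.actBy g) p).IsInvertible := by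
  have h1 : B.actBy g⁻¹ ∘ B.actBy g = id := by
    funext q; simp [actBy, B.act_mul, B.act_one]
  have h2 : B.actBy g ∘ B.actBy g⁻¹ = id := by
    funext q; simp [actBy, B.act_mul, B.act_one]
  have hq : B.actBy g⁻¹ (B.actBy g p) = p := congrFun h1 p
  have e1 : (mfderiv IP IP (B.actBy g⁻¹) (B.actBy g p)).comp (mfderiv IP IP (B.actBy g) p) =
      ContinuousLinearMap.id ℝ _ := by
    rw [← mfderiv_comp p (B.mdifferentiable_actBy _ _) (B.mdifferentiable_actBy _ _), h1,
      mfderiv_id]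
  have e2 := mfderiv_comp (B.actBy g p) (B.mdifferentiable_actBy g _)
    (B.mdifferentiable_actBy g⁻¹ _)
  rw [h2, mfderiv_id, hq] at e2
  exact .of_inverse e2.symm e1

/-- Invariance, stated as pushforward by `a_g`, turned into the pullback form in which naturality of
the Lie bracket is available. -/
theorem mpullback_actBy {X : ∀ p : P, TangentSpace IP p} (hX : B.IsInvariantField X) (g : G) :
    VectorField.mpullback IP IP (B.actBy g) X = X := by
  funext p
  rw [VectorField.mpullback_apply, ← hX g p]
  exact (B.isInvertible_mfderiv_actBy g p).inverse_apply_self _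

end Pointwise

section Atiyah

variable [IsManifold IP ∞ P] [LieGroup IG ∞ G] [FiniteDimensional ℝ EP]

theorem contMDiff_quotientMap :
    ContMDiff IP.tangent (IM.prod 𝓘(ℝ, EP)) ∞ B.quotientMap := by
  intro X
  let S := B.localSectionAt (B.proj X.proj)
  have hX : B.proj X.proj ∈ S.base := B.mem_localSectionAt _
  have hproj : ContMDiff IP.tangent IM ∞ (fun Y : TangentBundle IP P => B.proj Y.proj) :=
    B.smooth_proj.comp (contMDiff_proj _)
  refine (S.triv.contMDiffAt_iff (f := B.quotientMap) hX).2 ⟨hproj X, ?_⟩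
  exact S.contMDiffOn_coord_quotientMap.contMDiffAt
    ((S.isOpen_base.preimage hproj.continuous).mem_nhds hX)

variable {B} in
theorem LocalSection.contMDiffOn_lift (S : B.LocalSection) :
    ContMDiffOn (IM.prod 𝓘(ℝ, EP)) IP.tangent ∞ S.lift (TotalSpace.proj ⁻¹' S.base) :=
  (S.contMDiffOn_vector.comp (S.triv.contMDiffOn (n := ∞) (IB := IM))
    fun _ ha => ⟨ha, mem_univ _⟩).congr fun _ ha => (S.vector_coord ha).symm

/-- Near any point, `ι(u)` at `p` is the representative of `u(τ p)` on the local section, moved to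
`p` by the group component; every ingredient is smooth. -/
theorem contMDiff_inclusion (u : Cₛ^∞⟮IM; EP, B.AtiyahFibre⟯) :
    ContMDiff IP IP.tangent ∞
      (fun p => (⟨p, B.inclusion (fun m => u m) p⟩ : TangentBundle IP P)) := by
  intro p₀
  have : IsManifold IG ∞ G := inferInstance
  let S := B.localSectionAt (B.proj p₀)
  have hS : B.proj ⁻¹' S.base ∈ 𝓝 p₀ :=
    (S.isOpen_base.preimage B.smooth_proj.continuous).mem_nhds (B.mem_localSectionAt _)
  have hu : ContMDiff IP (IM.prod 𝓘(ℝ, EP)) ∞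
      (fun p => (⟨B.proj p, u (B.proj p)⟩ : TotalSpace EP B.AtiyahFibre)) :=
    u.contMDiff.comp B.smooth_proj
  have h : ContMDiffOn IP IP.tangent ∞
      (fun p => B.tangentAct (S.group p) (S.lift ⟨B.proj p, u (B.proj p)⟩)) (B.proj ⁻¹' S.base) :=
    B.contMDiff_tangentAct.comp_contMDiffOn
      ((S.contMDiffOn_lift.comp hu.contMDiffOn fun _ hp => hp).prodMk S.smooth_group)
  refine (h.congr fun p hp => ?_).contMDiffAt hS
  refine B.eq_of_quotientMap_eq ?_ ?_
  · rw [quotientMap_inclusion, quotientMap_tangentAct, S.quotientMap_lift]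
  · rw [proj_tangentAct, S.proj_lift ⟨B.proj p, u (B.proj p)⟩ hp, S.act_group p hp]

/-- The vector field on `P` determined by a smooth section of the Atiyah bundle. -/
def inclusionSection :
    Cₛ^∞⟮IM; EP, B.AtiyahFibre⟯ →ₗ[ℝ] Cₛ^∞⟮IP; EP, (TangentSpace IP : P → Type _)⟯ where
  toFun u := ⟨B.inclusion fun m => u m, B.contMDiff_inclusion u⟩
  map_add' u v := by ext p; exact map_add (B.fibreEquiv p).symm _ _
  map_smul' c u := by ext p; exact map_smul (B.fibreEquiv p).symm _ _

@[simp] theorem inclusionSection_apply (u : Cₛ^∞⟮IM; EP, B.AtiyahFibre⟯) (p : P) :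
    B.inclusionSection u p = B.inclusion (fun m => u m) p := rfl

/-- Surjectivity of `τ`. Identities between sections of `TP/G` can therefore be verified on `P`. -/
theorem inclusionSection_injective : Function.Injective B.inclusionSection := by
  intro u v h
  ext m
  obtain ⟨p, rfl⟩ := B.exists_proj_eq m
  exact (B.fibreEquiv p).symm.injective (congrArg (fun X => X p) h)

/-- The section of the Atiyah bundle determined by an invariant vector field. -/
def descend (X : Cₛ^∞⟮IP; EP, (TangentSpace IP : P → Type _)⟯)
    (hX : B.IsInvariantField fun p => X p) : Cₛ^∞⟮IM; EP, B.AtiyahFibre⟯ where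
  toFun m := B.mkEquiv (B.proj_pointOver m) (X (B.pointOver m))
  contMDiff_toFun := by
    intro m
    let S := B.localSectionAt m
    -- The points `B.pointOver x` need not vary smoothly with `x`. Invariance allows them to be
    -- replaced by the points of a smooth local section.
    have h : ContMDiffOn IM (IM.prod 𝓘(ℝ, EP)) ∞
        (fun x => B.quotientMap ⟨S.toFun x, X (S.toFun x)⟩) S.base :=
      (B.contMDiff_quotientMap.comp X.contMDiff).comp_contMDiffOn S.smooth_toFun
    refine (h.congr fun x hx => ?_).contMDiffAt
      (S.isOpen_base.mem_nhds (B.mem_localSectionAt m))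
    refine (B.mk_mkEquiv (B.proj_pointOver x) _).trans ?_
    exact hX.quotientMap_eq ((B.proj_pointOver x).trans (S.proj_toFun x hx).symm)

theorem inclusion_descend (X : Cₛ^∞⟮IP; EP, (TangentSpace IP : P → Type _)⟯)
    (hX : B.IsInvariantField fun p => X p) (p : P) :
    B.inclusion (fun m => B.descend X hX m) p = X p := by
  refine TotalSpace.mk_injective (F := EP) (E := (TangentSpace IP : P → Type _)) _
    (B.eq_of_quotientMap_eq ?_ rfl)
  rw [quotientMap_inclusion]
  refine (B.mk_mkEquiv (B.proj_pointOver (B.proj p)) _).trans ?_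
  exact hX.quotientMap_eq (B.proj_pointOver _)

theorem isAtiyahBundle : B.IsAtiyahBundle where
  smooth_quotientMap := B.contMDiff_quotientMap
  smooth_inclusion := B.contMDiff_inclusion
  invariant_inclusion u := B.isInvariantField_inclusion _
  exists_section X hX := by
    refine ⟨B.descend X hX, B.inclusion_descend X hX, fun u hu => ?_⟩
    refine B.inclusionSection_injective (ContMDiffSection.ext fun p => ?_)
    exact (hu p).trans (B.inclusion_descend X hX p).symm

end Atiyah

/-! ### The bracket of invariant fields -/

section Bracket

variable [IsManifold IP ∞ P]

theorem mdifferentiableAt_section (X : Cₛ^∞⟮IP; EP, (TangentSpace IP : P → Type _)⟯) (p : P) :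
    MDifferentiableAt IP IP.tangent (fun p => (⟨p, X p⟩ : TangentBundle IP P)) p :=
  X.contMDiff.mdifferentiable (by simp) p

variable [FiniteDimensional ℝ EP]

/-- Pullback along the diffeomorphism `a_g` commutes with the Lie bracket and fixes both fields. -/
theorem isInvariantField_mlieBracket {X Y : ∀ p : P, TangentSpace IP p}
    (hX : ContMDiff IP IP.tangent ∞ (fun p => (⟨p, X p⟩ : TangentBundle IP P)))
    (hY : ContMDiff IP IP.tangent ∞ (fun p => (⟨p, Y p⟩ : TangentBundle IP P)))
    (iX : B.IsInvariantField X) (iY : B.IsInvariantField Y) :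
    B.IsInvariantField (VectorField.mlieBracket IP X Y) := by
  intro g p
  have : CompleteSpace EP := FiniteDimensional.complete ℝ EP
  have : IsManifold IP (minSmoothness ℝ 2) P :=
    .of_le (m := minSmoothness ℝ 2) (n := ∞) (by simpa using ENat.LEInfty.out)
  have h := VectorField.mpullback_mlieBracket (f := B.actBy g) (x₀ := p) (n := ∞)
    (hX.mdifferentiable (by simp) _) (hY.mdifferentiable (by simp) _)
    (B.contMDiff_actBy g p) (by simpa using ENat.LEInfty.out)
  rw [B.mpullback_actBy iX, B.mpullback_actBy iY, VectorField.mpullback_apply] at h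
  rw [← h]
  exact (B.isInvertible_mfderiv_actBy g p).self_apply_inverse _

/-- The Lie bracket of two smooth vector fields, as a smooth vector field. -/
def fieldBracket (X Y : Cₛ^∞⟮IP; EP, (TangentSpace IP : P → Type _)⟯) :
    Cₛ^∞⟮IP; EP, (TangentSpace IP : P → Type _)⟯ where
  toFun := VectorField.mlieBracket IP (fun p => X p) (fun p => Y p)
  contMDiff_toFun := by
    have : CompleteSpace EP := FiniteDimensional.complete ℝ EP
    have : IsManifold IP (minSmoothness ℝ 2) P :=
      .of_le (m := minSmoothness ℝ 2) (n := ∞) (by simpa using ENat.LEInfty.out)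
    have : IsManifold IP (((⊤ : ℕ∞) : ℕ∞ω) + 1) P := inferInstanceAs (IsManifold IP ∞ P)
    exact fun p => ContMDiffAt.mlieBracket_vectorField (m := ⊤) (n := ⊤) (X.contMDiff p)
      (Y.contMDiff p) (by simp)

variable [LieGroup IG ∞ G]

/-- The bracket of two sections of the Atiyah bundle. -/
def sectionBracket (u v : Cₛ^∞⟮IM; EP, B.AtiyahFibre⟯) : Cₛ^∞⟮IM; EP, B.AtiyahFibre⟯ :=
  B.descend (fieldBracket (B.inclusionSection u) (B.inclusionSection v))
    (B.isInvariantField_mlieBracket (B.contMDiff_inclusion u) (B.contMDiff_inclusion v)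
      (B.isInvariantField_inclusion _) (B.isInvariantField_inclusion _))

theorem inclusionSection_sectionBracket (u v : Cₛ^∞⟮IM; EP, B.AtiyahFibre⟯) :
    B.inclusionSection (B.sectionBracket u v) =
      fieldBracket (B.inclusionSection u) (B.inclusionSection v) :=
  ContMDiffSection.ext fun p => B.inclusion_descend _ _ p

/-- The Lie bracket of vector fields, as a bilinear map. -/
def fieldBracketₗ : Cₛ^∞⟮IP; EP, (TangentSpace IP : P → Type _)⟯ →ₗ[ℝ]
    Cₛ^∞⟮IP; EP, (TangentSpace IP : P → Type _)⟯ →ₗ[ℝ]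
    Cₛ^∞⟮IP; EP, (TangentSpace IP : P → Type _)⟯ :=
  have : CompleteSpace EP := FiniteDimensional.complete ℝ EP
  LinearMap.mk₂ ℝ fieldBracket
    (fun X X' _ => ContMDiffSection.ext fun p => VectorField.mlieBracket_add_left
      (mdifferentiableAt_section X p) (mdifferentiableAt_section X' p))
    (fun _ X _ => ContMDiffSection.ext fun p => VectorField.mlieBracket_const_smul_left
      (mdifferentiableAt_section X p))
    (fun _ Y Y' => ContMDiffSection.ext fun p => VectorField.mlieBracket_add_right
      (mdifferentiableAt_section Y p) (mdifferentiableAt_section Y' p))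
    (fun _ _ Y => ContMDiffSection.ext fun p => VectorField.mlieBracket_const_smul_right
      (mdifferentiableAt_section Y p))

theorem fieldBracket_self (X : Cₛ^∞⟮IP; EP, (TangentSpace IP : P → Type _)⟯) :
    fieldBracket X X = 0 :=
  ContMDiffSection.ext fun p => congrFun VectorField.mlieBracket_self p

theorem fieldBracket_swap (X Y : Cₛ^∞⟮IP; EP, (TangentSpace IP : P → Type _)⟯) :
    fieldBracket X Y = -fieldBracket Y X :=
  ContMDiffSection.ext fun _ => VectorField.mlieBracket_swap_apply

/-- The derivation form of the Jacobi identity, made cyclic by antisymmetry. -/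
theorem fieldBracket_jacobi (X Y Z : Cₛ^∞⟮IP; EP, (TangentSpace IP : P → Type _)⟯) :
    fieldBracket X (fieldBracket Y Z) + fieldBracket Y (fieldBracket Z X) +
      fieldBracket Z (fieldBracket X Y) = 0 := by
  have : CompleteSpace EP := FiniteDimensional.complete ℝ EP
  have : IsManifold IP (minSmoothness ℝ 3) P := .of_le (n := ∞) (by simpa using ENat.LEInfty.out)
  have hs : minSmoothness ℝ 2 ≤ (∞ : ℕ∞ω) := by simpa using ENat.LEInfty.out
  have h : fieldBracket X (fieldBracket Y Z) =
      fieldBracket (fieldBracket X Y) Z + fieldBracket Y (fieldBracket X Z) :=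
    ContMDiffSection.ext fun p => VectorField.leibniz_identity_mlieBracket_apply
      ((X.contMDiff p).of_le hs) ((Y.contMDiff p).of_le hs) ((Z.contMDiff p).of_le hs)
  have h2 : fieldBracket Y (fieldBracket Z X) = -fieldBracket Y (fieldBracket X Z) := by
    rw [fieldBracket_swap Z X]
    exact map_neg (fieldBracketₗ Y) _
  rw [h, h2, fieldBracket_swap Z]
  abel

/-- The bracket of sections of the Atiyah bundle, as a bilinear map. -/
def sectionBracketₗ : Cₛ^∞⟮IM; EP, B.AtiyahFibre⟯ →ₗ[ℝ] Cₛ^∞⟮IM; EP, B.AtiyahFibre⟯ →ₗ[ℝ]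
    Cₛ^∞⟮IM; EP, B.AtiyahFibre⟯ :=
  LinearMap.mk₂ ℝ B.sectionBracket
    (fun u u' v => B.inclusionSection_injective <| by
      simp only [inclusionSection_sectionBracket, map_add]
      exact fieldBracketₗ.map_add₂ _ _ _)
    (fun c u v => B.inclusionSection_injective <| by
      simp only [inclusionSection_sectionBracket, map_smul]
      exact fieldBracketₗ.map_smul₂ _ _ _)
    (fun u v v' => B.inclusionSection_injective <| by
      simp only [inclusionSection_sectionBracket, map_add]
      exact (fieldBracketₗ _).map_add _ _)
    (fun c u v => B.inclusionSection_injective <| by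
      simp only [inclusionSection_sectionBracket, map_smul]
      exact (fieldBracketₗ _).map_smul _ _)

theorem sectionBracket_self (u : Cₛ^∞⟮IM; EP, B.AtiyahFibre⟯) : B.sectionBracket u u = 0 :=
  B.inclusionSection_injective <| by
    rw [inclusionSection_sectionBracket, fieldBracket_self, map_zero]

theorem sectionBracket_jacobi (u v w : Cₛ^∞⟮IM; EP, B.AtiyahFibre⟯) :
    B.sectionBracket u (B.sectionBracket v w) + B.sectionBracket v (B.sectionBracket w u) +
      B.sectionBracket w (B.sectionBracket u v) = 0 :=
  B.inclusionSection_injective <| by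
    simp only [map_add, inclusionSection_sectionBracket, fieldBracket_jacobi, map_zero]

end Bracket

/-! ### The anchor and the Atiyah algebroid -/

section Anchor

/-- The map of a fibre of the Atiyah bundle to the tangent space of the base that is induced by the
differential of the projection. -/
def anchorMap (m : M) : B.AtiyahFibre m →ₗ[ℝ] TangentSpace IM m :=
  -- The differential ends in the tangent space at `B.proj (B.pointOver m)`, equal to `m` only
  -- propositionally; as types both tangent spaces are `EM`.
  LinearMap.comp (M₃ := TangentSpace IM m)
    (mfderiv IP IM B.proj (B.pointOver m)).toLinearMap
    (B.mkEquiv (B.proj_pointOver m)).symm.toLinearMap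

theorem tangentMap_proj_tangentAct (g : G) (X : TangentBundle IP P) :
    tangentMap IP IM B.proj (B.tangentAct g X) = tangentMap IP IM B.proj X := by
  have : B.proj ∘ B.actBy g = B.proj := funext fun p => B.proj_act p g
  conv_rhs => rw [← this]
  rw [tangentMap_comp (B.smooth_proj.mdifferentiable (by simp)) (B.mdifferentiable_actBy g)]
  rfl

/-- Vectors with the same class differ by the action, which `dτ` does not see. Hence the anchor can
be computed from any representative. -/
theorem tangentMap_proj_eq {X Y : TangentBundle IP P} (h : B.quotientMap X = B.quotientMap Y) :
    tangentMap IP IM B.proj X = tangentMap IP IM B.proj Y := by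
  obtain ⟨g, hg⟩ := B.exists_act_eq (congrArg TotalSpace.proj h)
  have : B.tangentAct g X = Y :=
    B.eq_of_quotientMap_eq ((B.quotientMap_tangentAct g X).trans h) hg
  rw [← this, tangentMap_proj_tangentAct]

theorem mk_anchorMap {m : M} (a : B.AtiyahFibre m) {X : TangentBundle IP P}
    (hX : B.quotientMap X = ⟨m, a⟩) :
    (⟨m, B.anchorMap m a⟩ : TangentBundle IM M) = tangentMap IP IM B.proj X := by
  have key : ∀ {x y : M} (_ : x = y) (v : EM),
      (⟨x, v⟩ : TangentBundle IM M) = ⟨y, v⟩ := by rintro x _ rfl v; rfl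
  have h : B.quotientMap ⟨B.pointOver m, (B.mkEquiv (B.proj_pointOver m)).symm a⟩ = ⟨m, a⟩ := by
    rw [← B.mk_mkEquiv (B.proj_pointOver m), LinearEquiv.apply_symm_apply]
  rw [B.tangentMap_proj_eq (hX.trans h.symm)]
  exact key (B.proj_pointOver m).symm _

theorem anchorMap_fibreEquiv (p : P) (v : TangentSpace IP p) :
    B.anchorMap (B.proj p) (B.fibreEquiv p v) = mfderiv IP IM B.proj p v :=
  TotalSpace.mk_injective (F := EM) (E := (TangentSpace IM : M → Type _)) _
    (B.mk_anchorMap (X := ⟨p, v⟩) _ rfl)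

theorem anchorMap_inclusion (u : ∀ m, B.AtiyahFibre m) (p : P) :
    B.anchorMap (B.proj p) (u (B.proj p)) = mfderiv IP IM B.proj p (B.inclusion u p) := by
  rw [← anchorMap_fibreEquiv, inclusion, LinearEquiv.apply_symm_apply]

variable [IsManifold IP ∞ P] [IsManifold IM ∞ M] [LieGroup IG ∞ G] [FiniteDimensional ℝ EP]

theorem contMDiff_anchorMap : ContMDiff (IM.prod 𝓘(ℝ, EP)) IM.tangent ∞
    (fun a : TotalSpace EP B.AtiyahFibre =>
      (⟨a.proj, B.anchorMap a.proj a.snd⟩ : TangentBundle IM M)) := by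
  intro a₀
  let S := B.localSectionAt a₀.proj
  have h := (B.smooth_proj.contMDiff_tangentMap (m := ∞) (by simp)).comp_contMDiffOn
    S.contMDiffOn_lift
  refine (h.congr fun a _ => B.mk_anchorMap a.snd (S.quotientMap_lift a)).contMDiffAt
    ((S.isOpen_base.preimage B.continuous_proj).mem_nhds (B.mem_localSectionAt _))

/-- The Atiyah algebroid of a principal bundle. -/
def atiyahAlgebroid : LieAlgebroid IM EP B.AtiyahFibre where
  bracket := B.sectionBracketₗ
  bracket_self := B.sectionBracket_self
  jacobi := B.sectionBracket_jacobi
  anchor := B.anchorMap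
  smooth_anchor := B.contMDiff_anchorMap
  leibniz u v f x := by
    have : CompleteSpace EP := FiniteDimensional.complete ℝ EP
    obtain ⟨p, rfl⟩ := B.exists_proj_eq x
    have hf : MDifferentiableAt IP 𝓘(ℝ, ℝ) (f ∘ B.proj) p :=
      (f.contMDiff.comp B.smooth_proj).mdifferentiable (by simp) p
    have hv := mdifferentiableAt_section (B.inclusionSection v) p
    -- On `P` the identity becomes the Leibniz rule for fields with the function `f ∘ τ`; the chain
    -- rule then turns `ι(u)(f ∘ τ)` into the derivative of `f` along the anchor.
    have h1 : (fun p => B.inclusionSection (smulSection f v) p) =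
        (f ∘ B.proj) • (fun p => B.inclusionSection v p) :=
      funext fun q => map_smul (B.fibreEquiv q).symm _ _
    have h2 := VectorField.mlieBracket_smul_right (V := fun p => B.inclusionSection u p) hf hv
    rw [← h1] at h2
    have h3 : ∀ w : Cₛ^∞⟮IM; EP, B.AtiyahFibre⟯,
        (B.fibreEquiv p).symm (B.sectionBracket u w (B.proj p)) =
        VectorField.mlieBracket IP (fun p => B.inclusionSection u p)
          (fun p => B.inclusionSection w p) p :=
      fun w => congrArg (fun X => X p) (B.inclusionSection_sectionBracket u w)
    apply (B.fibreEquiv p).symm.injective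
    rw [map_add, map_smul, map_smul]
    refine (h3 _).trans (h2.trans ?_)
    refine congrArg₂ (· + ·) (congrArg (· • _) ?_) (congrArg (f (B.proj p) • ·) (h3 v).symm)
    rw [anchorMap_inclusion, dirDeriv]
    change mfderiv IP 𝓘(ℝ, ℝ) (f ∘ B.proj) p (B.inclusion (fun m => u m) p) = _
    rw [mfderiv_comp p (f.contMDiff.mdifferentiable (by simp) _)
      (B.smooth_proj.mdifferentiable (by simp) p)]
    rfl

theorem isAtiyahAlgebroid : IsAtiyahAlgebroid B.atiyahAlgebroid where
  bracket u v p := congrArg (fun X => X p) (B.inclusionSection_sectionBracket u v)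
  anchor := B.anchorMap_fibreEquiv

end Anchor

end PrincipalBundle

/-! ### Global sections through a vector, and invariance of a field under its flow -/

section Flows

variable {E : Type*} [NormedAddCommGroup E] [NormedSpace ℝ E]
  {H : Type*} [TopologicalSpace H] {I : ModelWithCorners ℝ E H}
  {M : Type*} [TopologicalSpace M] [ChartedSpace H M]

/-- Every vector of a smooth vector bundle is a value of a global smooth section. -/
theorem exists_contMDiffSection_eq [FiniteDimensional ℝ E] [IsManifold I ∞ M]
    [SigmaCompactSpace M] [T2Space M] {F : Type*} [NormedAddCommGroup F] [NormedSpace ℝ F]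
    {V : M → Type*} [∀ x, AddCommGroup (V x)] [∀ x, Module ℝ (V x)]
    [∀ x, TopologicalSpace (V x)] [TopologicalSpace (TotalSpace F V)] [FiberBundle F V]
    [VectorBundle ℝ F V] [ContMDiffVectorBundle ∞ F V I] {x : M} (a : V x) :
    ∃ s : Cₛ^∞⟮I; F, V⟯, s x = a := by
  classical
  -- The value is prescribed at `x` and free elsewhere. These constraints are convex and locally
  -- solvable, so a partition of unity glues local solutions.
  let t : ∀ y, Set (V y) := Function.update (fun _ => univ) x {a}
  have h1 : ∀ y, Convex ℝ (t y) := by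
    intro y
    rcases eq_or_ne y x with rfl | h
    · simp [t]
    · simp [t, h, convex_univ]
  have h2 : ∀ y, ∃ U ∈ 𝓝 y, ∃ s : ∀ z, V z,
      ContMDiffOn I (I.prod 𝓘(ℝ, F)) ((⊤ : ℕ∞) : ℕ∞ω) (fun z => TotalSpace.mk' F z (s z)) U ∧
      ∀ z ∈ U, s z ∈ t z := by
    intro y
    rcases eq_or_ne y x with rfl | h
    · obtain ⟨U, hU, hs⟩ := FiberBundle.exists_contMDiffOn_extend (k := ∞) I F a
      refine ⟨U, hU, FiberBundle.extend F a, hs, fun z _ => ?_⟩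
      rcases eq_or_ne z y with rfl | h
      · simp [t]
      · simp [t, h]
    · refine ⟨{x}ᶜ, isOpen_compl_singleton.mem_nhds h, fun _ => 0,
        (contMDiff_zeroSection ℝ V).contMDiffOn, fun z hz => ?_⟩
      have hz : z ≠ x := hz
      simp [t, hz]
  obtain ⟨s, hs⟩ := exists_contMDiffSection_forall_mem_convex_of_local I V t h1 h2
  exact ⟨s, by simpa [t] using hs x⟩

/-- A vector field is invariant under its own local flow. -/
theorem IsLocalFlow.mfderiv_apply [IsManifold I ∞ M] [BoundarylessManifold I M] [T2Space M]
    {X : ∀ x : M, TangentSpace I x}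
    (hX : ContMDiff I I.tangent ∞ (fun x => (⟨x, X x⟩ : TangentBundle I M)))
    {U : Set M} {ε : ℝ} {Φ : ℝ → M → M} (h : IsLocalFlow I X U ε Φ) {t : ℝ}
    (ht : t ∈ Ioo (-ε) ε) {y : M} (hy : y ∈ U) :
    mfderiv I I (Φ t) y (X y) = X (Φ t y) := by
  have h0 : (0 : ℝ) ∈ Ioo (-ε) ε := ⟨by linarith [ht.1, ht.2], by linarith [ht.1, ht.2]⟩
  let γ : ℝ → M := fun s => Φ s y
  have hγ : IsMIntegralCurveOn γ X (Ioo (-ε) ε) := h.integralCurve y hy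
  have hγ0 : γ 0 = y := h.zero y hy
  have hd0 : HasMFDerivAt 𝓘(ℝ, ℝ) I γ 0 ((1 : ℝ →L[ℝ] ℝ).smulRight (X (γ 0))) :=
    (hγ.isMIntegralCurveAt (isOpen_Ioo.mem_nhds h0)).hasMFDerivAt
  have hdt : HasMFDerivAt 𝓘(ℝ, ℝ) I (γ ∘ (· + t)) 0
      ((1 : ℝ →L[ℝ] ℝ).smulRight (X ((γ ∘ (· + t)) 0))) := by
    have := (hγ.isMIntegralCurveAt (isOpen_Ioo.mem_nhds ht)).comp_add t
    rw [sub_self] at this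
    exact this.hasMFDerivAt
  have hΦ : MDifferentiableAt I I (Φ t) (γ 0) := by
    have hs : ContMDiffOn I I ∞ (fun z => Φ t z) U :=
      h.smooth.comp (contMDiff_const.prodMk contMDiff_id).contMDiffOn fun z hz => ⟨ht, hz⟩
    rw [hγ0]
    exact (hs.contMDiffAt (h.isOpen.mem_nhds hy)).mdifferentiableAt (by simp)
  -- The group law `Φ_{s+t}(y) = Φ_t(Φ_s(y))` for small `s`, from uniqueness of integral curves.
  -- Differentiating it at `s = 0` gives the claim.
  have hev : γ ∘ (· + t) =ᶠ[𝓝 0] Φ t ∘ γ := by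
    have e1 : ∀ᶠ s in 𝓝 (0 : ℝ), γ s ∈ U :=
      hd0.continuousAt.eventually_mem (h.isOpen.mem_nhds (hγ0 ▸ hy))
    have e2 : ∀ᶠ s in 𝓝 (0 : ℝ), s + t ∈ Ioo (-ε) ε :=
      (continuous_add_const t).continuousAt.eventually_mem
        (isOpen_Ioo.mem_nhds (by simpa using ht))
    filter_upwards [e1, e2, isOpen_Ioo.mem_nhds h0] with s hs hst hs0
    have c1 := h.integralCurve (γ s) hs
    have c2 := hγ.comp_add s
    -- Both `r ↦ Φ r (γ s)` and `r ↦ γ (r + s)` are integral curves on this interval. It contains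
    -- `0`, where they agree, and `t`, where they are to be compared.
    have h0' : (0 : ℝ) ∈ Ioo (max (-ε) (-ε - s)) (min ε (ε - s)) :=
      ⟨max_lt h0.1 (by linarith [hs0.1]), lt_min h0.2 (by linarith [hs0.2])⟩
    have ht' : t ∈ Ioo (max (-ε) (-ε - s)) (min ε (ε - s)) :=
      ⟨max_lt ht.1 (by linarith [hst.1]), lt_min ht.2 (by linarith [hst.2])⟩
    have := isMIntegralCurveOn_Ioo_eqOn_of_contMDiff_boundaryless (γ := fun r => Φ r (γ s))
      (γ' := γ ∘ (· + s)) h0' (hX.of_le (by simp))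
      (c1.mono (Ioo_subset_Ioo (le_max_left _ _) (min_le_left _ _)))
      (c2.mono fun r hr => ⟨by linarith [(le_max_right _ _).trans_lt hr.1],
        by linarith [hr.2.trans_le (min_le_right _ _)]⟩)
      (by simp [h.zero _ hs]) ht'
    simp only [Function.comp_apply] at this ⊢
    rw [this, add_comm]
  have hu := hasMFDerivAt_unique ((hΦ.hasMFDerivAt.comp 0 hd0).congr_of_eventuallyEq hev) hdt
  have key : ∀ z w : M, z = y → w = Φ t y → (mfderiv I I (Φ t) z (X z) : E) = (X w : E) →
      mfderiv I I (Φ t) y (X y) = X (Φ t y) := by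
    rintro _ _ rfl rfl h
    exact h
  refine key (γ 0) ((γ ∘ (· + t)) 0) hγ0 (by simp [γ]) ?_
  have := congrArg (fun L : ℝ →L[ℝ] E => L 1) hu
  exact ((congrArg _ (one_smul ℝ (X (γ 0)))).symm.trans this).trans (one_smul ℝ _)

/-- The distribution spanned by a smooth vector field is integrable. -/
theorem isIntegrableDistribution_span [IsManifold I ∞ M] [BoundarylessManifold I M] [T2Space M]
    (X : Cₛ^∞⟮I; E, (TangentSpace I : M → Type _)⟯) :
    IsIntegrableDistribution (fun x => Submodule.span ℝ {X x}) := by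
  refine ⟨{X}, fun x => by simp, ?_⟩
  intro Y hY U ε Φ h t ht y hy
  rw [mem_singleton_iff] at hY
  subst hY
  rw [Submodule.map_span, image_singleton]
  exact congrArg (fun v => Submodule.span ℝ {v}) (h.mfderiv_apply (ContMDiffSection.contMDiff _) ht hy)

end Flows

/-! ### Reduction of an invariant Carrollian structure -/

namespace PrincipalBundle

variable {EP : Type*} [NormedAddCommGroup EP] [NormedSpace ℝ EP]
  {HP : Type*} [TopologicalSpace HP] {IP : ModelWithCorners ℝ EP HP}
  {EM : Type*} [NormedAddCommGroup EM] [NormedSpace ℝ EM]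
  {HM : Type*} [TopologicalSpace HM] {IM : ModelWithCorners ℝ EM HM}
  {EG : Type*} [NormedAddCommGroup EG] [NormedSpace ℝ EG]
  {HG : Type*} [TopologicalSpace HG] {IG : ModelWithCorners ℝ EG HG}
  {P : Type*} [TopologicalSpace P] [ChartedSpace HP P]
  {M : Type*} [TopologicalSpace M] [ChartedSpace HM M]
  {G : Type*} [TopologicalSpace G] [ChartedSpace HG G] [Group G]
  {B : PrincipalBundle IP IM IG P M G} [IsManifold IP ∞ P] {S : CarrollianStructure IP P}

namespace IsInvariant

variable (B S) in
/-- The bilinear form on a fibre of the Atiyah bundle induced by a metric on `P`. -/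
def reducedForm (m : M) : B.AtiyahFibre m →ₗ[ℝ] B.AtiyahFibre m →ₗ[ℝ] ℝ :=
  (S.g.form (B.pointOver m)).compl₁₂ (B.mkEquiv (B.proj_pointOver m)).symm.toLinearMap
    (B.mkEquiv (B.proj_pointOver m)).symm.toLinearMap

/-- Any point over `m` is reached from the auxiliary one by some `g`, and `a_g` is an isometry; so
the auxiliary point does not matter. -/
theorem reducedForm_mkEquiv (hS : B.IsInvariant S) {m : M} {p : P} (h : B.proj p = m) (v w : TangentSpace IP p) :
    reducedForm B S m (B.mkEquiv h v) (B.mkEquiv h w) = S.g.form p v w := by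
  obtain ⟨g, rfl⟩ := B.exists_act_eq ((B.proj_pointOver m).trans h.symm)
  have key : ∀ v : TangentSpace IP (B.actBy g (B.pointOver m)), ∃ v',
      v = mfderiv IP IP (B.actBy g) (B.pointOver m) v' ∧
      (B.mkEquiv (B.proj_pointOver m)).symm (B.mkEquiv h v) = v' := by
    intro v
    refine ⟨_, (B.mkEquiv h).injective ?_, rfl⟩
    refine ((B.mkEquiv (B.proj_pointOver m)).apply_symm_apply _).symm.trans ?_
    exact (B.mkAt_act (B.proj_pointOver m) g _).symm
  obtain ⟨v', hv, hv'⟩ := key v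
  obtain ⟨w', hw, hw'⟩ := key w
  rw [reducedForm, LinearMap.compl₁₂_apply]
  refine (congrArg₂ (fun a b => S.g.form (B.pointOver m) a b) hv' hw').trans ?_
  rw [hv, hw]
  exact (hS.metric g _ v' w').symm

theorem reducedForm_fibreEquiv (hS : B.IsInvariant S) (p : P) (v w : TangentSpace IP p) :
    reducedForm B S (B.proj p) (B.fibreEquiv p v) (B.fibreEquiv p w) = S.g.form p v w :=
  hS.reducedForm_mkEquiv rfl v w

variable (hS : B.IsInvariant S) [LieGroup IG ∞ G] [FiniteDimensional ℝ EP]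

/-- The metric on the Atiyah bundle induced by an invariant Carrollian structure. -/
def reducedMetric : BundleMetric IM EP B.AtiyahFibre where
  form := reducedForm B S
  symm m a b := S.g.symm _ _ _
  smooth u v := by
    -- Pulled back to `P`, the pairing is that of the two invariant fields; composing with a local
    -- section returns smoothness to `M`.
    have h : ContMDiff IP 𝓘(ℝ, ℝ) ∞
        ((fun m => reducedForm B S m (u m) (v m)) ∘ B.proj) := by
      refine (S.g.smooth (B.inclusionSection u) (B.inclusionSection v)).congr fun p => ?_
      rw [← hS.reducedForm_fibreEquiv, inclusionSection_apply, inclusionSection_apply, inclusion,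
        inclusion, LinearEquiv.apply_symm_apply, LinearEquiv.apply_symm_apply]
      rfl
    intro m
    let s := B.localSectionAt m
    refine ((h.comp_contMDiffOn s.smooth_toFun).congr fun x hx => ?_).contMDiffAt
      (s.isOpen_base.mem_nhds (B.mem_localSectionAt m))
    have key : ∀ y, y = x → reducedForm B S x (u x) (v x) = reducedForm B S y (u y) (v y) := by
      rintro _ rfl; rfl
    exact key _ (s.proj_toFun x hx)

/-- The section of the Atiyah bundle corresponding to the Carroll vector field. -/
def carrollSection : Cₛ^∞⟮IM; EP, B.AtiyahFibre⟯ := B.descend S.κ hS.field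

theorem inclusion_carrollSection (p : P) :
    B.inclusion (fun m => hS.carrollSection m) p = S.κ p := B.inclusion_descend _ _ p

theorem fibreEquiv_kappa (p : P) :
    B.fibreEquiv p (S.κ p) = hS.carrollSection (B.proj p) := by
  rw [← hS.inclusion_carrollSection, inclusion, LinearEquiv.apply_symm_apply]

theorem carrollSection_ne_zero (m : M) : hS.carrollSection m ≠ 0 := by
  obtain ⟨p, rfl⟩ := B.exists_proj_eq m
  rw [← hS.fibreEquiv_kappa]
  exact (B.fibreEquiv p).map_ne_zero_iff.2 (S.κ_ne_zero p)

theorem reducedForm_eq_zero_iff (m : M) (a : B.AtiyahFibre m) :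
    (∀ b, reducedForm B S m a b = 0) ↔ a ∈ Submodule.span ℝ {hS.carrollSection m} := by
  obtain ⟨p, rfl⟩ := B.exists_proj_eq m
  obtain ⟨v, rfl⟩ := (B.fibreEquiv p).surjective a
  rw [(B.fibreEquiv p).surjective.forall]
  simp only [hS.reducedForm_fibreEquiv, S.ker_eq_span, ← hS.fibreEquiv_kappa,
    Submodule.mem_span_singleton, ← map_smul, (B.fibreEquiv p).injective.eq_iff]

variable [IsManifold IM ∞ M] [FiniteDimensional ℝ EM] [T2Space M] [SigmaCompactSpace M]
  [Nonempty P]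

/-- The Carrollian Lie algebroid induced by an invariant Carrollian structure. -/
def carrollianLieAlgebroid : CarrollianLieAlgebroid IM EP B.AtiyahFibre where
  toLieAlgebroid := B.atiyahAlgebroid
  metric := hS.reducedMetric
  degenerate h := by
    have h0 : hS.carrollSection ∈ hS.reducedMetric.ker := fun v m =>
      (hS.reducedForm_eq_zero_iff m _).2 (Submodule.mem_span_singleton_self _) (v m)
    rw [h, mem_singleton_iff] at h0
    exact hS.carrollSection_ne_zero (B.proj (Classical.arbitrary P)) (by rw [h0]; rfl)
  L m := Submodule.span ℝ {hS.carrollSection m}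
  trivial_L := ⟨hS.carrollSection, fun m => ⟨hS.carrollSection_ne_zero m, rfl⟩⟩
  ker_eq := by
    ext u
    refine ⟨fun hu m => (hS.reducedForm_eq_zero_iff m _).1 fun b => ?_,
      fun hu v m => (hS.reducedForm_eq_zero_iff m _).2 (hu m) (v m)⟩
    -- The kernel tests only against global sections; every vector `b` of the fibre is a value of
    -- one.
    obtain ⟨s, rfl⟩ := exists_contMDiffSection_eq (I := IM) (F := EP) b
    exact hu s m

theorem isInducedBy_carrollianLieAlgebroid : IsInducedBy hS.carrollianLieAlgebroid S where
  atiyah := B.isAtiyahAlgebroid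
  metric := hS.reducedForm_fibreEquiv
  line := ⟨hS.carrollSection, hS.inclusion_carrollSection, fun _ => rfl⟩

/-- The vector field on `M` spanning the Carroll distribution. -/
def anchorCarrollSection : Cₛ^∞⟮IM; EM, (TangentSpace IM : M → Type _)⟯ where
  toFun m := B.anchorMap m (hS.carrollSection m)
  contMDiff_toFun := B.contMDiff_anchorMap.comp hS.carrollSection.contMDiff

theorem carrollDistribution_eq :
    hS.carrollianLieAlgebroid.carrollDistribution =
      fun m => Submodule.span ℝ {hS.anchorCarrollSection m} := by
  funext m
  change (Submodule.span ℝ {hS.carrollSection m}).map (B.anchorMap m) = _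
  rw [Submodule.map_span, image_singleton]
  rfl

theorem carrollDistribution_proj (p : P) :
    hS.carrollianLieAlgebroid.carrollDistribution (B.proj p) =
      Submodule.span ℝ {mfderiv IP IM B.proj p (S.κ p)} := by
  rw [carrollDistribution_eq, ← B.anchorMap_fibreEquiv, hS.fibreEquiv_kappa]
  rfl

end IsInvariant

end PrincipalBundle

/-! ### Global flows and their generators -/

section Generators

variable {E : Type*} [NormedAddCommGroup E] [NormedSpace ℝ E]
  {H : Type*} [TopologicalSpace H] {I : ModelWithCorners ℝ E H}
  {M : Type*} [TopologicalSpace M] [ChartedSpace H M]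
  {V : Type*} [NormedAddCommGroup V] [NormedSpace ℝ V]

/-- The derivative of a smooth vector-valued function along a smooth vector field is smooth. -/
theorem contMDiff_mfderiv_apply [IsManifold I ∞ M] {f : M → V} (hf : ContMDiff I 𝓘(ℝ, V) ∞ f)
    (X : Cₛ^∞⟮I; E, (TangentSpace I : M → Type _)⟯) :
    ContMDiff I 𝓘(ℝ, V) ∞ (fun p => (mfderiv I 𝓘(ℝ, V) f p (X p) : V)) :=
  (contMDiff_snd_tangentBundle_modelSpace V 𝓘(ℝ, V)).comp
    ((hf.contMDiff_tangentMap (m := ∞) (by simp)).comp X.contMDiff)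

/-- A smooth flow, defined for all times. -/
structure SmoothFlow (I : ModelWithCorners ℝ E H) (M : Type*) [TopologicalSpace M]
    [ChartedSpace H M] where
  toFun : M → ℝ → M
  smooth : ContMDiff (I.prod 𝓘(ℝ, ℝ)) I ∞ (fun x : M × ℝ => toFun x.1 x.2)
  zero : ∀ p, toFun p 0 = p
  add : ∀ p s t, toFun (toFun p s) t = toFun p (s + t)

namespace SmoothFlow

variable (Φ : SmoothFlow I M)

theorem contMDiff_curve (p : M) : ContMDiff 𝓘(ℝ, ℝ) I ∞ (Φ.toFun p) :=
  Φ.smooth.comp (contMDiff_const.prodMk contMDiff_id)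

theorem mdifferentiable_curve (p : M) : MDifferentiable 𝓘(ℝ, ℝ) I (Φ.toFun p) :=
  (Φ.contMDiff_curve p).mdifferentiable (by simp)

/-- The vector field generating a flow. -/
def generator (p : M) : TangentSpace I p := (mfderiv 𝓘(ℝ, ℝ) I (Φ.toFun p) 0 (1 : ℝ) : E)

theorem mk_generator (p : M) : (⟨p, Φ.generator p⟩ : TangentBundle I M) =
    tangentMap 𝓘(ℝ, ℝ) I (Φ.toFun p) ⟨0, (1 : ℝ)⟩ := by
  have key : ∀ {x y : M} (_ : x = y) (v : E),
      (⟨x, v⟩ : TangentBundle I M) = ⟨y, v⟩ := by rintro x _ rfl v; rfl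
  exact key (Φ.zero p).symm _

/-- A map commuting with the flow carries orbits to orbits with the same parameter, hence preserves
their initial velocity. -/
theorem mfderiv_generator_eq {f : M → M} (hf : MDifferentiable I I f) (p : M)
    (h : ∀ t, f (Φ.toFun p t) = Φ.toFun (f p) t) :
    mfderiv I I f p (Φ.generator p) = Φ.generator (f p) := by
  refine TotalSpace.mk_injective (F := E) (E := (TangentSpace I : M → Type _)) _ ?_
  rw [mk_generator]
  change tangentMap I I f ⟨p, Φ.generator p⟩ = _
  rw [mk_generator, ← Function.comp_apply (f := tangentMap I I f),
    ← tangentMap_comp hf (Φ.mdifferentiable_curve p)]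
  congr 1
  exact funext h

/-- The chain rule along an orbit: derivatives along the generator become one-variable derivatives,
with no charts on the circle. -/
theorem mfderiv_generator {f : M → V} (hf : MDifferentiable I 𝓘(ℝ, V) f) (p : M) {v : V}
    (h : HasDerivAt (fun t => f (Φ.toFun p t)) v 0) :
    (mfderiv I 𝓘(ℝ, V) f p (Φ.generator p) : V) = v := by
  have h1 : tangentMap I 𝓘(ℝ, V) f ⟨p, Φ.generator p⟩ =
      tangentMap 𝓘(ℝ, ℝ) 𝓘(ℝ, V) (f ∘ Φ.toFun p) ⟨0, (1 : ℝ)⟩ := by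
    rw [mk_generator, tangentMap_comp hf (Φ.mdifferentiable_curve p)]
    rfl
  have h2 : (mfderiv I 𝓘(ℝ, V) f p (Φ.generator p) : V) =
      mfderiv 𝓘(ℝ, ℝ) 𝓘(ℝ, V) (f ∘ Φ.toFun p) 0 (1 : ℝ) :=
    congrArg (fun X : TangentBundle 𝓘(ℝ, V) V => (X.snd : V)) h1
  rw [h2, mfderiv_eq_fderiv]
  exact h.deriv

theorem isMIntegralCurve_generator (p : M) :
    IsMIntegralCurve (I := I) (Φ.toFun p) Φ.generator := by
  intro t
  have h1 : Φ.toFun p = Φ.toFun (Φ.toFun p t) ∘ (fun s => s - t) := by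
    funext s
    simp [Φ.add]
  have h2 : HasMFDerivAt 𝓘(ℝ, ℝ) 𝓘(ℝ, ℝ) (fun s : ℝ => s - t) t
      (ContinuousLinearMap.id ℝ ℝ) :=
    ((hasFDerivAt_id t).sub_const t).hasMFDerivAt
  have h3 : (1 : ℝ →L[ℝ] ℝ).smulRight (Φ.generator (Φ.toFun p t) : E) =
      (mfderiv 𝓘(ℝ, ℝ) I (Φ.toFun (Φ.toFun p t)) 0 : ℝ →L[ℝ] E) :=
    ContinuousLinearMap.ext_ring (one_smul ℝ _)
  have h4 : HasMFDerivAt 𝓘(ℝ, ℝ) I (Φ.toFun (Φ.toFun p t)) ((fun s : ℝ => s - t) t)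
      ((1 : ℝ →L[ℝ] ℝ).smulRight (Φ.generator (Φ.toFun p t))) := by
    rw [show (fun s : ℝ => s - t) t = 0 from sub_self t]
    exact (congrArg (HasMFDerivAt 𝓘(ℝ, ℝ) I (Φ.toFun (Φ.toFun p t)) 0) h3).mpr
      (Φ.mdifferentiable_curve (Φ.toFun p t) 0).hasMFDerivAt
  have h5 := HasMFDerivAt.comp (f := fun s : ℝ => s - t) t h4 h2
  rw [← h1] at h5
  exact h5

variable [IsManifold I ∞ M]

/-- The generator of a flow, as a smooth vector field. -/
def generatorSection : Cₛ^∞⟮I; E, (TangentSpace I : M → Type _)⟯ where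
  toFun := Φ.generator
  contMDiff_toFun := by
    -- The generator is the differential of the flow map `M × ℝ → M` on the smooth family of vectors
    -- `(0_p, ∂_t)` at time `0`.
    have h1 : ContMDiff I (I.prod 𝓘(ℝ, ℝ)).tangent ∞
        (fun p : M => (equivTangentBundleProd I M 𝓘(ℝ, ℝ) ℝ).symm
          (zeroSection E (TangentSpace I : M → Type _) p, ⟨0, (1 : ℝ)⟩)) :=
      contMDiff_equivTangentBundleProd_symm.comp
        ((contMDiff_zeroSection ℝ _).prodMk contMDiff_const)
    refine ((Φ.smooth.contMDiff_tangentMap (m := ∞) (by simp)).comp h1).congr fun p => ?_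
    refine (Φ.mk_generator p).trans ?_
    have h2 : Φ.toFun p = (fun x : M × ℝ => Φ.toFun x.1 x.2) ∘ (fun t => (p, t)) := rfl
    have h3 : MDifferentiable 𝓘(ℝ, ℝ) (I.prod 𝓘(ℝ, ℝ)) (fun t : ℝ => (p, t)) :=
      (contMDiff_const.prodMk contMDiff_id :
        ContMDiff 𝓘(ℝ, ℝ) (I.prod 𝓘(ℝ, ℝ)) ∞ _).mdifferentiable (by simp)
    rw [h2, tangentMap_comp (Φ.smooth.mdifferentiable (by simp)) h3, Function.comp_apply,
      tangentMap_prod_right]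
    rfl

end SmoothFlow

end Generators

/-! ### A singular Carroll distribution on the cylinder -/

namespace Cylinder

/-- The model of the cylinder. -/
local notation "𝓒" => ModelWithCorners.prod 𝓘(ℝ, ℝ) (𝓡 1)

/-- The trivial principal circle bundle over the line. -/
def bundle : PrincipalBundle 𝓒 𝓘(ℝ, ℝ) (𝓡 1) (ℝ × Circle) ℝ Circle where
  proj := Prod.fst
  act p g := (p.1, p.2 * g)
  smooth_proj := contMDiff_fst
  smooth_act := (contMDiff_fst.comp contMDiff_fst).prodMk
    ((contMDiff_snd.comp contMDiff_fst).mul contMDiff_snd)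
  act_one p := by simp
  act_mul p g h := by simp [mul_assoc]
  proj_act _ _ := rfl
  locally_trivial m := by
    let e : Trivialization Circle (Prod.fst : ℝ × Circle → ℝ) :=
      { toOpenPartialHomeomorph := OpenPartialHomeomorph.refl _
        baseSet := univ
        open_baseSet := isOpen_univ
        source_eq := by simp
        target_eq := by simp
        proj_toFun := fun _ _ => rfl }
    exact ⟨e, mem_univ m, contMDiff_id.contMDiffOn, contMDiff_id.contMDiffOn, fun _ _ _ => rfl⟩

/-- The flow which dilates the line and rotates the circle. -/
def spiral : SmoothFlow 𝓒 (ℝ × Circle) where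
  toFun p t := (p.1 * Real.exp t, p.2 * Circle.exp t)
  smooth := by
    refine ContMDiff.prodMk ?_ ?_
    · exact (contMDiff_fst.comp contMDiff_fst).mul
        (Real.contDiff_exp.contMDiff.comp contMDiff_snd)
    · exact (contMDiff_snd.comp contMDiff_fst).mul (contMDiff_circleExp.comp contMDiff_snd)
  zero p := by simp
  add p s t := by simp [Real.exp_add, mul_assoc]

/-- The translation flow along the line. -/
def translation : SmoothFlow 𝓒 (ℝ × Circle) where
  toFun p t := (p.1 + t, p.2)
  smooth := ((contMDiff_fst.comp contMDiff_fst).add contMDiff_snd).prodMk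
    (contMDiff_snd.comp contMDiff_fst)
  zero p := by simp
  add p s t := by simp [add_assoc]

/-- The second projection, as a complex-valued function. -/
def angular (p : ℝ × Circle) : ℂ := p.2

theorem contMDiff_angular : ContMDiff 𝓒 𝓘(ℝ, ℂ) ∞ angular :=
  have : Fact (Module.finrank ℝ ℂ = 1 + 1) := ⟨Complex.finrank_real_complex⟩
  (contMDiff_coe_sphere (E := ℂ) (n := 1)).comp contMDiff_snd

theorem contMDiff_radial : ContMDiff 𝓒 𝓘(ℝ, ℝ) ∞ (Prod.fst : ℝ × Circle → ℝ) := contMDiff_fst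

/-- The 1-form `dx` on the cylinder. -/
def dx (p : ℝ × Circle) : TangentSpace 𝓒 p →ₗ[ℝ] ℝ :=
  (mfderiv 𝓒 𝓘(ℝ, ℝ) (Prod.fst : ℝ × Circle → ℝ) p).toLinearMap

/-- The 1-form `dz` on the cylinder. -/
def dz (p : ℝ × Circle) : TangentSpace 𝓒 p →ₗ[ℝ] ℂ := (mfderiv 𝓒 𝓘(ℝ, ℂ) angular p).toLinearMap

/-- The angular 1-form on the cylinder. -/
def dθ (p : ℝ × Circle) : TangentSpace 𝓒 p →ₗ[ℝ] ℝ :=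
  Complex.imLm ∘ₗ LinearMap.mulLeft ℝ ((starRingEnd ℂ) (angular p)) ∘ₗ dz p

theorem dθ_apply (p : ℝ × Circle) (v : TangentSpace 𝓒 p) :
    dθ p v = ((starRingEnd ℂ) (angular p) * dz p v).im := rfl

/-- The 1-form `dx - x dθ` on the cylinder. -/
def coform (p : ℝ × Circle) : TangentSpace 𝓒 p →ₗ[ℝ] ℝ := dx p - p.1 • dθ p

theorem coform_apply (p : ℝ × Circle) (v : TangentSpace 𝓒 p) :
    coform p v = dx p v - p.1 * dθ p v := rfl

theorem conj_angular_mul (p : ℝ × Circle) : (starRingEnd ℂ) (angular p) * angular p = 1 := by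
  rw [mul_comm, Complex.mul_conj, angular, Circle.normSq_coe, Complex.ofReal_one]

theorem dx_spiral (p : ℝ × Circle) : dx p (spiral.generator p) = p.1 := by
  refine spiral.mfderiv_generator (contMDiff_radial.mdifferentiable (by simp)) p ?_
  have h := (Real.hasDerivAt_exp 0).const_mul p.1
  rw [Real.exp_zero, mul_one] at h
  exact h

theorem dθ_spiral (p : ℝ × Circle) : dθ p (spiral.generator p) = 1 := by
  have h : dz p (spiral.generator p) = angular p * Complex.I := by
    refine spiral.mfderiv_generator (contMDiff_angular.mdifferentiable (by simp)) p ?_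
    have h1 : HasDerivAt (fun t : ℝ => Complex.exp (t * Complex.I)) Complex.I 0 := by
      have := ((hasDerivAt_id (0 : ℝ)).ofReal_comp.mul_const Complex.I).cexp
      simpa using this
    simpa [angular, spiral, Circle.coe_exp] using h1.const_mul (angular p)
  rw [dθ_apply, h, ← mul_assoc, conj_angular_mul, one_mul, Complex.I_im]

theorem dx_translation (p : ℝ × Circle) : dx p (translation.generator p) = 1 := by
  refine translation.mfderiv_generator (contMDiff_radial.mdifferentiable (by simp)) p ?_
  exact (hasDerivAt_id 0).const_add p.1

theorem dθ_translation (p : ℝ × Circle) : dθ p (translation.generator p) = 0 := by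
  have h : dz p (translation.generator p) = 0 :=
    translation.mfderiv_generator (contMDiff_angular.mdifferentiable (by simp)) p
      (hasDerivAt_const 0 (angular p))
  rw [dθ_apply, h, mul_zero, Complex.zero_im]

theorem coform_spiral (p : ℝ × Circle) : coform p (spiral.generator p) = 0 := by
  rw [coform_apply, dx_spiral, dθ_spiral, mul_one, sub_self]

theorem coform_translation (p : ℝ × Circle) : coform p (translation.generator p) = 1 := by
  rw [coform_apply, dx_translation, dθ_translation, mul_zero, sub_zero]

/-- The forms `coform` and `dθ` are dual to the two generators. -/
theorem linearIndependent_generators (p : ℝ × Circle) :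
    LinearIndependent ℝ ![translation.generator p, spiral.generator p] := by
  rw [LinearIndependent.pair_iff]
  intro s t h
  have h1 := congrArg (coform p) h
  have h2 := congrArg (dθ p) h
  simp only [map_add, map_smul, coform_translation, coform_spiral, dθ_translation, dθ_spiral,
    map_zero, smul_eq_mul, mul_one, mul_zero, add_zero, zero_add] at h1 h2
  exact ⟨h1, h2⟩

theorem finrank_tangentSpace (p : ℝ × Circle) : Module.finrank ℝ (TangentSpace 𝓒 p) = 2 := by
  change Module.finrank ℝ (ℝ × EuclideanSpace ℝ (Fin 1)) = 2
  simp

/-- The frame of the tangent bundle of the cylinder given by the two flows. -/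
def frame (p : ℝ × Circle) : Module.Basis (Fin 2) ℝ (TangentSpace 𝓒 p) :=
  basisOfLinearIndependentOfCardEqFinrank (linearIndependent_generators p)
    (by rw [finrank_tangentSpace, Fintype.card_fin])

theorem coe_frame (p : ℝ × Circle) :
    ⇑(frame p) = ![translation.generator p, spiral.generator p] :=
  coe_basisOfLinearIndependentOfCardEqFinrank _ _

theorem mem_span_spiral {p : ℝ × Circle} {v : TangentSpace 𝓒 p} :
    v ∈ Submodule.span ℝ {spiral.generator p} ↔ coform p v = 0 := by
  rw [Submodule.mem_span_singleton]
  constructor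
  · rintro ⟨c, rfl⟩
    rw [map_smul, coform_spiral, smul_zero]
  · intro h
    have hv := (frame p).sum_repr v
    simp only [Fin.sum_univ_two, coe_frame, Matrix.cons_val_zero, Matrix.cons_val_one] at hv
    refine ⟨(frame p).repr v 1, ?_⟩
    rw [← hv, map_add, map_smul, map_smul, coform_translation, coform_spiral, smul_zero,
      add_zero, smul_eq_mul, mul_one] at h
    rw [h, zero_smul, zero_add] at hv
    exact hv

/-- The degenerate metric `(dx - x dθ)²` on the cylinder. -/
def metric : BundleMetric 𝓒 (ℝ × EuclideanSpace ℝ (Fin 1))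
    (TangentSpace 𝓒 : ℝ × Circle → Type _) where
  form p := (LinearMap.mul ℝ ℝ).compl₁₂ (coform p) (coform p)
  symm p v w := mul_comm _ _
  smooth u v := by
    have h : ∀ u : Cₛ^∞⟮𝓒; ℝ × EuclideanSpace ℝ (Fin 1), (TangentSpace 𝓒 : ℝ × Circle → Type _)⟯,
        ContMDiff 𝓒 𝓘(ℝ, ℝ) ∞ (fun p => coform p (u p)) := by
      intro u
      have h1 := contMDiff_mfderiv_apply contMDiff_radial u
      have h2 := contMDiff_mfderiv_apply contMDiff_angular u
      have h3 : ContMDiff 𝓒 𝓘(ℝ, ℂ) ∞ (fun p => (starRingEnd ℂ) (angular p)) :=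
        Complex.conjCLE.contDiff.contMDiff.comp contMDiff_angular
      have h4 : ContMDiff 𝓒 𝓘(ℝ, ℝ) ∞ (fun p => dθ p (u p)) :=
        Complex.imCLM.contDiff.contMDiff.comp
          ((contDiff_mul (𝕜 := ℝ) (𝔸 := ℂ)).contMDiff.comp (h3.prodMk_space h2))
      exact h1.sub (contMDiff_radial.mul h4)
    exact (h u).mul (h v)

theorem metric_form_apply (p : ℝ × Circle) (v w : TangentSpace 𝓒 p) :
    metric.form p v w = coform p v * coform p w := rfl

/-- A Carrollian structure on the cylinder whose Carroll vector field is tangent to the fibres over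
one point of the line only. -/
def carrollianStructure : CarrollianStructure 𝓒 (ℝ × Circle) where
  g := metric
  κ := spiral.generatorSection
  diagonal p := by
    -- In `frame` the translation comes first and the spiral last, so the null direction sits at
    -- `Fin.last 1`.
    refine ⟨1, frame p, fun i j => ?_⟩
    rw [metric_form_apply, coe_frame]
    fin_cases i <;> fin_cases j <;> simp [coform_translation, coform_spiral]
  κ_ne_zero p h := by
    have h1 := dθ_spiral p
    rw [show spiral.generator p = 0 from h, map_zero] at h1
    exact zero_ne_one h1
  complete p := ⟨spiral.toFun p, spiral.zero p, spiral.isMIntegralCurve_generator p⟩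
  ker_eq_span p v := by
    refine Iff.trans ⟨fun h => ?_, fun h w => ?_⟩ mem_span_spiral.symm
    · simpa [metric_form_apply, coform_translation] using h (translation.generator p)
    · rw [metric_form_apply, h, zero_mul]

theorem dx_actBy (g : Circle) (p : ℝ × Circle) (v : TangentSpace 𝓒 p) :
    dx (bundle.actBy g p) (mfderiv 𝓒 𝓒 (bundle.actBy g) p v) = dx p v := by
  have h := mfderiv_comp p (contMDiff_radial.mdifferentiable (by simp) (bundle.actBy g p))
    (bundle.mdifferentiable_actBy g p)
  exact (congrArg (fun L => L v) h).symm

theorem dz_actBy (g : Circle) (p : ℝ × Circle) (v : TangentSpace 𝓒 p) :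
    dz (bundle.actBy g p) (mfderiv 𝓒 𝓒 (bundle.actBy g) p v) = dz p v * g := by
  have h := mfderiv_comp p (contMDiff_angular.mdifferentiable (by simp) (bundle.actBy g p))
    (bundle.mdifferentiable_actBy g p)
  have h2 : HasMFDerivAt 𝓘(ℝ, ℂ) 𝓘(ℝ, ℂ) (fun w : ℂ => w * (g : ℂ)) (angular p)
      ((ContinuousLinearMap.mul ℝ ℂ).flip (g : ℂ)) :=
    ((ContinuousLinearMap.mul ℝ ℂ).flip (g : ℂ)).hasFDerivAt.hasMFDerivAt
  have h3 := (h2.comp p (contMDiff_angular.mdifferentiable (by simp) p).hasMFDerivAt).mfderiv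
  have h4 : angular ∘ bundle.actBy g = (fun w : ℂ => w * (g : ℂ)) ∘ angular := by
    funext q; simp [angular, PrincipalBundle.actBy, bundle]
  rw [← h4] at h3
  exact (congrArg (fun L => L v) h).symm.trans (congrArg (fun L => L v) h3)

/-- Rotation by `g` multiplies `z̄ dz` by `ḡ g = 1`. -/
theorem dθ_actBy (g : Circle) (p : ℝ × Circle) (v : TangentSpace 𝓒 p) :
    dθ (bundle.actBy g p) (mfderiv 𝓒 𝓒 (bundle.actBy g) p v) = dθ p v := by
  have h : angular (bundle.actBy g p) = angular p * g := by
    simp [angular, PrincipalBundle.actBy, bundle]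
  have hg : (starRingEnd ℂ) (g : ℂ) * g = 1 := conj_angular_mul (0, g)
  rw [dθ_apply, dθ_apply, dz_actBy, h, map_mul]
  congr 1
  linear_combination ((starRingEnd ℂ) (angular p) * dz p v) * hg

theorem coform_actBy (g : Circle) (p : ℝ × Circle) (v : TangentSpace 𝓒 p) :
    coform (bundle.actBy g p) (mfderiv 𝓒 𝓒 (bundle.actBy g) p v) = coform p v := by
  rw [coform_apply, coform_apply, dx_actBy, dθ_actBy]
  rfl

theorem isInvariant_carrollianStructure : bundle.IsInvariant carrollianStructure where
  metric g p v w := congrArg₂ (· * ·) (coform_actBy g p v) (coform_actBy g p w)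
  field g p := spiral.mfderiv_generator_eq (bundle.mdifferentiable_actBy g) p fun t => by
    simp [spiral, PrincipalBundle.actBy, bundle, mul_right_comm]

theorem isSingularDistribution : IsSingularDistribution
    isInvariant_carrollianStructure.carrollianLieAlgebroid.carrollDistribution := by
  intro h
  have key : ∀ x : ℝ, Module.finrank ℝ
      (isInvariant_carrollianStructure.carrollianLieAlgebroid.carrollDistribution x) =
      Module.finrank ℝ (Submodule.span ℝ {x}) := by
    intro x
    have h1 := isInvariant_carrollianStructure.carrollDistribution_proj (x, 1)
    -- The differential of the projection is `dx`, whose value on the spiral field is the coordinate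
    -- `x`. The rank at `x` is thus the dimension of the span of the number `x`.
    have h2 : mfderiv 𝓒 𝓘(ℝ, ℝ) bundle.proj (x, 1) (carrollianStructure.κ (x, 1)) = x :=
      dx_spiral (x, 1)
    rw [h2] at h1
    exact congrArg (fun D : Submodule ℝ ℝ => Module.finrank ℝ D) h1
  have h01 := h (0 : ℝ) (1 : ℝ)
  rw [key, key, finrank_span_singleton one_ne_zero, Submodule.span_zero_singleton,
    finrank_bot] at h01
  exact zero_ne_one h01

end Cylinder

end

/-! ### The main theorem -/

theorem mainTheorem8 :
    (∀ {EP : Type*} [NormedAddCommGroup EP] [NormedSpace ℝ EP] [FiniteDimensional ℝ EP]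
      {HP : Type*} [TopologicalSpace HP] (IP : ModelWithCorners ℝ EP HP) [IP.Boundaryless]
      {EM : Type*} [NormedAddCommGroup EM] [NormedSpace ℝ EM] [FiniteDimensional ℝ EM]
      {HM : Type*} [TopologicalSpace HM] (IM : ModelWithCorners ℝ EM HM) [IM.Boundaryless]
      {EG : Type*} [NormedAddCommGroup EG] [NormedSpace ℝ EG] [FiniteDimensional ℝ EG]
      {HG : Type*} [TopologicalSpace HG] (IG : ModelWithCorners ℝ EG HG) [IG.Boundaryless]
      (P : Type*) [TopologicalSpace P] [ChartedSpace HP P] [IsManifold IP ∞ P]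
      [T2Space P] [SecondCountableTopology P] [Nonempty P]
      (M : Type*) [TopologicalSpace M] [ChartedSpace HM M] [IsManifold IM ∞ M]
      [T2Space M] [SecondCountableTopology M]
      (G : Type*) [TopologicalSpace G] [ChartedSpace HG G] [Group G] [LieGroup IG ∞ G]
      [T2Space G] [SecondCountableTopology G]
      (B : PrincipalBundle IP IM IG P M G) (S : CarrollianStructure IP P),
      B.IsInvariant S →
      ∃ (_ : FiberBundle EP B.AtiyahFibre) (_ : VectorBundle ℝ EP B.AtiyahFibre)
        (_ : ContMDiffVectorBundle ∞ EP B.AtiyahFibre IM),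
        B.IsAtiyahBundle ∧
        ∃ 𝒜 : CarrollianLieAlgebroid IM EP B.AtiyahFibre,
          PrincipalBundle.IsInducedBy 𝒜 S ∧
          (∀ (m : M) (a : B.AtiyahFibre m),
            (∀ b, 𝒜.metric.form m a b = 0) ↔ a ∈ 𝒜.L m) ∧
          (∀ p : P, 𝒜.carrollDistribution (B.proj p) =
            Submodule.span ℝ {mfderiv IP IM B.proj p (S.κ p)}) ∧
          IsIntegrableDistribution 𝒜.carrollDistribution) ∧
    (∃ (B : PrincipalBundle (𝓘(ℝ, ℝ).prod (𝓡 1)) 𝓘(ℝ, ℝ) (𝓡 1) (ℝ × Circle) ℝ Circle)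
      (S : CarrollianStructure (𝓘(ℝ, ℝ).prod (𝓡 1)) (ℝ × Circle)),
      B.IsInvariant S ∧
      ∃ (_ : FiberBundle (ℝ × EuclideanSpace ℝ (Fin 1)) B.AtiyahFibre)
        (_ : VectorBundle ℝ (ℝ × EuclideanSpace ℝ (Fin 1)) B.AtiyahFibre)
        (_ : ContMDiffVectorBundle ∞ (ℝ × EuclideanSpace ℝ (Fin 1)) B.AtiyahFibre 𝓘(ℝ, ℝ)),
        B.IsAtiyahBundle ∧
        ∃ 𝒜 : CarrollianLieAlgebroid 𝓘(ℝ, ℝ) (ℝ × EuclideanSpace ℝ (Fin 1)) B.AtiyahFibre,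
          PrincipalBundle.IsInducedBy 𝒜 S ∧
          IsSingularDistribution 𝒜.carrollDistribution) := by
  refine ⟨?_, ?_⟩
  · intro EP _ _ _ HP _ IP _ EM _ _ _ HM _ IM _ EG _ _ _ HG _ IG _ P _ _ _ _ _ _ M _ _ _ _ _
      G _ _ _ _ _ _ B S hS
    -- Together with second countability this gives σ-compactness, as needed for the partitions of
    -- unity behind global sections.
    have : LocallyCompactSpace M := Manifold.locallyCompact_of_finiteDimensional IM
    exact ⟨inferInstance, inferInstance, inferInstance, B.isAtiyahBundle,
      hS.carrollianLieAlgebroid, hS.isInducedBy_carrollianLieAlgebroid,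
      hS.reducedForm_eq_zero_iff, hS.carrollDistribution_proj,
      hS.carrollDistribution_eq ▸ isIntegrableDistribution_span _⟩
  · exact ⟨Cylinder.bundle, Cylinder.carrollianStructure,
      Cylinder.isInvariant_carrollianStructure, inferInstance, inferInstance, inferInstance,
      Cylinder.bundle.isAtiyahBundle,
      Cylinder.isInvariant_carrollianStructure.carrollianLieAlgebroid,
      Cylinder.isInvariant_carrollianStructure.isInducedBy_carrollianLieAlgebroid,
      Cylinder.isSingularDistribution⟩
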